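/- Conventions. A topos is a Grothendieck topos, i.e. a category equivalent to the category of sheaves of sets on a small site. $\mathsf{Topoi}$ is the 2-category of topoi, geometric morphisms $f=(f^*\dashv f_*)$ with $f^*$ left exact, and 2-cells $f\Rightarrow g$ the natural transformations $f^*\Rightarrow g^*$. $\mathsf{Lex}$ is the 2-category of small categories with finite limits, finite-limit-preserving functors and natural transformations. A topos is free if it is equivalent to $\mathsf{Psh}(\mathcal C)=[\mathcal C^{\mathrm{op}},\mathsf{Set}]$ for some $\mathcal C\in\mathsf{Lex}$. A geometric morphism $f$ is an embedding if $f_*$ is fully faithful, and ethereal if $f_*$ preserves all small colimits. $\mathsf{FreeTopoi}$ is the locally full sub-2-category of $\mathsf{Topoi}$ of free topoi and ethereal geometric morphisms. In a 2-category, a right Kan extension of $x:A\to X$ along $f:A\to B$ is a 1-cell $\mathrm{ran}_f x:B\to X$ with a 2-cell $\varepsilon:(\mathrm{ran}_f x)\circ f\Rightarrow x$ such that every 2-cell $y\circ f\Rightarrow x$ factors through $\varepsilon$ via a unique 2-cell $y\Rightarrow \mathrm{ran}_f x$. For a class $\mathcal H$ of 1-cells, $\mathsf{WRInj}(\mathcal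 H)$ is the locally full sub-2-category whose objects are those $X$ for which $\mathrm{ran}_f x$ exists for all $f:A\to B$ in $\mathcal H$ and all $x:A\to X$ (the weakly right Kan injective objects), and whose 1-cells are those preserving these right Kan extensions; $\mathsf{RInj}(\mathcal H)$ is defined in the same way with all $\varepsilon$ moreover required to be invertible (the right Kan injective objects). $Y$ is a retract of $X$ if there are $s:Y\to X$ and $r:X\to Y$ with $r s\cong 1_Y$, and a coadjoint retract if moreover $s\dashv r$ can be required. Let $\mathsf{Topoi}_{\mathrm{lex}}^{\mathrm{co}}$ be the 2-category of topoi, left exact functors, and natural transformations with reversed direction. A right Kan extension in $\mathsf{Topoi}$ is pointwise if $(-)_*:\mathsf{Topoi}\to\mathsf{Topoi}_{\mathrm{lex}}^{\mathrm{co}}$, $f\mapsto f_*$, takes it to a right Kan extension; $\mathsf{WRInj}_{\mathsf{pw}}(\mathcal H)$ is the full sub-2-category of $\mathsf{WRInj}(\mathcal H)$ on the objects whose right Kan extensions along members of $\mathcal H$ are all pointwise. Let $\mathcal H_{\mathrm{all}}$ be the class of all geometric morphisms and $\mathcal H_{\mathrm{emb}}$ the class of embeddings. Theorem. (a) For a topos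 $\mathcal E$ the following are equivalent: (1) $\mathcal E$ is a coadjoint retract of a free topos; (1') $\mathcal E$ is a retract of a free topos; (2) $\mathcal E\in\mathsf{RInj}(\mathcal H_{\mathrm{emb}})$; (3) $\mathcal E\in\mathsf{WRInj}_{\mathsf{pw}}(\mathcal H_{\mathrm{all}})$. (b) The presheaf construction $\mathsf{Psh}:\mathsf{Lex}^{\mathrm{op}}\to\mathsf{FreeTopoi}$, which sends a left exact functor $F:\mathcal D\to\mathcal C$ to the geometric morphism $\mathsf{Psh}(\mathcal C)\to\mathsf{Psh}(\mathcal D)$ whose direct image is restriction along $F$, is a biequivalence. (c) $\mathsf{FreeTopoi}$ is contained in $\mathsf{WRInj}(\mathcal H_{\mathrm{all}})$, and the inclusion is 2-fully faithful, i.e. an isomorphism on hom-categories. The coadjoint retracts in $\mathsf{Topoi}$ of the objects in its image are exactly the objects of $\mathsf{WRInj}_{\mathsf{pw}}(\mathcal H_{\mathrm{all}})$. (d) A geometric morphism between objects of $\mathsf{WRInj}(\mathcal H_{\mathrm{all}})$ is a 1-cell of $\mathsf{WRInj}(\mathcal H_{\mathrm{all}})$ if and only if it is ethereal. -/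

import Mathlib

universe w v u w₂ v₂ u₂

namespace KanTopoi

open CategoryTheory CategoryTheory.Limits
open scoped CategoryTheory.Bicategory

noncomputable section

/-! ## Kan extensions and Kan injectivity in a bicategory -/

section TwoCategories

variable {K : Type u} [Bicategory.{w, v} K]

/-- The 1-cell `r : B ⟶ X` with the 2-cell `κ : f ≫ r ⟶ x` is a right Kan extension of
`x : A ⟶ X` along `f : A ⟶ B`. -/
def IsRightKan {A B X : K} (f : A ⟶ B) (x : A ⟶ X) (r : B ⟶ X) (κ : f ≫ r ⟶ x) : Prop :=
  Nonempty (Bicategory.RightExtension.mk r κ).IsKan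

theorem isRightKan_iff {A B X : K} {f : A ⟶ B} {x : A ⟶ X} {r : B ⟶ X} {κ : f ≫ r ⟶ x} :
    IsRightKan f x r κ ↔
      ∀ (y : B ⟶ X) (α : f ≫ y ⟶ x), ∃! β : y ⟶ r, f ◁ β ≫ κ = α := by
  constructor
  · rintro ⟨h⟩ y α
    refine ⟨CostructuredArrow.IsUniversal.lift h (Bicategory.RightExtension.mk y α),
      CostructuredArrow.IsUniversal.fac h (Bicategory.RightExtension.mk y α), fun β hβ => ?_⟩
    refine CostructuredArrow.IsUniversal.hom_ext h ?_
    exact hβ.trans (CostructuredArrow.IsUniversal.fac h (Bicategory.RightExtension.mk y α)).symm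
  · intro h
    refine ⟨IsTerminal.ofUniqueHom
      (fun s => Bicategory.RightExtension.homMk
        (h (Bicategory.RightExtension.extension s) (Bicategory.RightExtension.counit s)).choose
        (h (Bicategory.RightExtension.extension s)
          (Bicategory.RightExtension.counit s)).choose_spec.1) fun s m => ?_⟩
    apply CostructuredArrow.hom_ext
    exact (h (Bicategory.RightExtension.extension s)
      (Bicategory.RightExtension.counit s)).choose_spec.2 m.left (Bicategory.RightExtension.w m)

/-- Being a right Kan extension is invariant under invertible 2-cells. -/
theorem IsRightKan.of_iso {A B X : K} {f : A ⟶ B} {x x' : A ⟶ X} {r r' : B ⟶ X}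
    {κ : f ≫ r ⟶ x} (h : IsRightKan f x r κ) (i : r' ≅ r) (e : x ≅ x') :
    IsRightKan f x' r' (f ◁ i.hom ≫ κ ≫ e.hom) := by
  rw [isRightKan_iff] at h ⊢
  intro y α
  obtain ⟨β, hβ, hu⟩ := h y (α ≫ e.inv)
  refine ⟨β ≫ i.inv, ?_, fun γ hγ => ?_⟩
  · simp [reassoc_of% hβ]
  · rw [← hu (γ ≫ i.hom) (by simp [← hγ])]
    simp

/-- The 1-cell `h : X ⟶ Y` preserves the right Kan extensions (of all 1-cells into `X`)
along `f`. -/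
def PreservesRightKan {X Y : K} (h : X ⟶ Y) {A B : K} (f : A ⟶ B) : Prop :=
  ∀ (x : A ⟶ X) (r : B ⟶ X) (κ : f ≫ r ⟶ x), IsRightKan f x r κ →
    IsRightKan f (x ≫ h) (r ≫ h) ((α_ f r h).inv ≫ κ ▷ h)

theorem preservesRightKan_id (X : K) {A B : K} (f : A ⟶ B) : PreservesRightKan (𝟙 X) f := by
  intro x r κ h
  have := h.of_iso (ρ_ r) (ρ_ x).symm
  simpa using this

theorem PreservesRightKan.comp {X Y Z : K} {h : X ⟶ Y} {k : Y ⟶ Z} {A B : K} {f : A ⟶ B}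
    (hh : PreservesRightKan h f) (hk : PreservesRightKan k f) : PreservesRightKan (h ≫ k) f := by
  intro x r κ hr
  have := (hk _ _ _ (hh _ _ _ hr)).of_iso (α_ r h k).symm (α_ x h k)
  simpa using this

/-- `X` is weakly right Kan injective with respect to `f`. -/
def IsWeaklyRightKanInjective (X : K) {A B : K} (f : A ⟶ B) : Prop :=
  ∀ x : A ⟶ X, ∃ (r : B ⟶ X) (κ : f ≫ r ⟶ x), IsRightKan f x r κ

/-- `X` is right Kan injective with respect to `f`: moreover the counits are invertible. -/
def IsRightKanInjective (X : K) {A B : K} (f : A ⟶ B) : Prop :=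
  ∀ x : A ⟶ X, ∃ (r : B ⟶ X) (κ : f ≫ r ⟶ x), IsRightKan f x r κ ∧ IsIso κ

/-- `Y` is a retract of `X` (up to an invertible 2-cell). -/
def IsRetract (Y X : K) : Prop :=
  ∃ (s : Y ⟶ X) (r : X ⟶ Y), Nonempty (s ≫ r ≅ 𝟙 Y)

/-- `Y` is a coadjoint retract of `X`: there is a 1-cell `r : X ⟶ Y` with a left adjoint
`s : Y ⟶ X` such that `r ∘ s ≅ 1`. -/
def IsCoadjointRetract (Y X : K) : Prop :=
  ∃ (s : Y ⟶ X) (r : X ⟶ Y), Nonempty (Bicategory.Adjunction s r) ∧ Nonempty (s ≫ r ≅ 𝟙 Y)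

variable (K) in
/-- A locally full sub-2-category of `K`: a class of objects and a class of 1-cells closed under
identities and composition; all 2-cells between these 1-cells are kept. -/
structure LocallyFullSub where
  obj : K → Prop
  hom : ∀ {a b : K}, (a ⟶ b) → Prop
  id_mem : ∀ a : K, hom (𝟙 a)
  comp_mem : ∀ {a b c : K} {f : a ⟶ b} {g : b ⟶ c}, hom f → hom g → hom (f ≫ g)

namespace LocallyFullSub

/-- The objects of a locally full sub-2-category. -/
structure Obj (S : LocallyFullSub K) where
  val : K
  property : S.obj val

/-- The 1-cells of a locally full sub-2-category. -/
@[ext]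
structure Hom {S : LocallyFullSub K} (a b : S.Obj) where
  val : a.val ⟶ b.val
  property : S.hom val

/-- The 2-cells of a locally full sub-2-category. -/
@[ext]
structure Hom₂ {S : LocallyFullSub K} {a b : S.Obj} (f g : Hom a b) where
  val : f.val ⟶ g.val

instance (S : LocallyFullSub K) : CategoryStruct S.Obj where
  Hom a b := Hom a b
  id a := ⟨𝟙 a.val, S.id_mem _⟩
  comp f g := ⟨f.val ≫ g.val, S.comp_mem f.property g.property⟩

instance (S : LocallyFullSub K) (a b : S.Obj) : Category (a ⟶ b) where
  Hom f g := Hom₂ f g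
  id f := ⟨𝟙 f.val⟩
  comp η θ := ⟨η.val ≫ θ.val⟩
  id_comp _ := Hom₂.ext (Category.id_comp _)
  comp_id _ := Hom₂.ext (Category.comp_id _)
  assoc _ _ _ := Hom₂.ext (Category.assoc _ _ _)

/-- The 1-cell of `K` underlying a 1-cell of `S`. -/
def val₁ {S : LocallyFullSub K} {a b : S.Obj} (f : a ⟶ b) : a.val ⟶ b.val := Hom.val f

theorem val₁_mem {S : LocallyFullSub K} {a b : S.Obj} (f : a ⟶ b) : S.hom (val₁ f) :=
  Hom.property f

/-- The 2-cell of `K` underlying a 2-cell of `S`. -/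
def val₂ {S : LocallyFullSub K} {a b : S.Obj} {f g : a ⟶ b} (η : f ⟶ g) : val₁ f ⟶ val₁ g :=
  Hom₂.val η

/-- An invertible 2-cell of `K` between 1-cells of `S` is an invertible 2-cell of `S`. -/
def isoMk {S : LocallyFullSub K} {a b : S.Obj} {f g : a ⟶ b} (e : f.val ≅ g.val) : f ≅ g where
  hom := ⟨e.hom⟩
  inv := ⟨e.inv⟩
  hom_inv_id := Hom₂.ext e.hom_inv_id
  inv_hom_id := Hom₂.ext e.inv_hom_id

instance (S : LocallyFullSub K) : Bicategory S.Obj where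
  whiskerLeft f _ _ η := Hom₂.mk (f.val ◁ val₂ η)
  whiskerRight η h := Hom₂.mk (val₂ η ▷ h.val)
  associator f g h := isoMk (α_ f.val g.val h.val)
  leftUnitor f := isoMk (λ_ f.val)
  rightUnitor f := isoMk (ρ_ f.val)
  whiskerLeft_id _ _ := Hom₂.ext (Bicategory.whiskerLeft_id _ _)
  whiskerLeft_comp _ _ _ _ _ _ := Hom₂.ext (Bicategory.whiskerLeft_comp _ _ _)
  id_whiskerLeft _ := Hom₂.ext (Bicategory.id_whiskerLeft _)
  comp_whiskerLeft _ _ _ _ _ := Hom₂.ext (Bicategory.comp_whiskerLeft _ _ _)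
  id_whiskerRight _ _ := Hom₂.ext (Bicategory.id_whiskerRight _ _)
  comp_whiskerRight _ _ _ := Hom₂.ext (Bicategory.comp_whiskerRight _ _ _)
  whiskerRight_id _ := Hom₂.ext (Bicategory.whiskerRight_id _)
  whiskerRight_comp _ _ _ := Hom₂.ext (Bicategory.whiskerRight_comp _ _ _)
  whisker_assoc _ _ _ _ _ := Hom₂.ext (Bicategory.whisker_assoc _ _ _)
  whisker_exchange _ _ := Hom₂.ext (Bicategory.whisker_exchange _ _)
  pentagon _ _ _ _ := Hom₂.ext (Bicategory.pentagon _ _ _ _)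
  triangle _ _ := Hom₂.ext (Bicategory.triangle _ _)

/-- `S` is contained in `T`: the objects of `S` are objects of `T`, and the 1-cells of `S` between
objects of `S` are 1-cells of `T`. -/
def Contained (S T : LocallyFullSub K) : Prop :=
  (∀ a : K, S.obj a → T.obj a) ∧
    ∀ (a b : K) (f : a ⟶ b), S.obj a → S.obj b → S.hom f → T.hom f

/-- The inclusion of locally full sub-2-categories. -/
def inclusion {S T : LocallyFullSub K} (h : S.Contained T) : Pseudofunctor S.Obj T.Obj where
  obj a := ⟨a.val, h.1 _ a.property⟩
  map {a b} f := Hom.mk (val₁ (a := a) (b := b) f)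
    (h.2 _ _ _ a.property b.property (val₁_mem (a := a) (b := b) f))
  map₂ {a b f g} η := Hom₂.mk (val₂ (a := a) (b := b) (f := f) (g := g) η)
  map₂_id _ := rfl
  map₂_comp _ _ := rfl
  mapId a := isoMk (Iso.refl (𝟙 a.val))
  mapComp f g := isoMk (Iso.refl ((val₁ f) ≫ (val₁ g)))
  map₂_whisker_left f _ _ η := Hom₂.ext (by
    change (val₁ f) ◁ (val₂ η) = 𝟙 _ ≫ (val₁ f) ◁ (val₂ η) ≫ 𝟙 _; simp)
  map₂_whisker_right η h := Hom₂.ext (by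
    change (val₂ η) ▷ (val₁ h) = 𝟙 _ ≫ (val₂ η) ▷ (val₁ h) ≫ 𝟙 _; simp)
  map₂_associator f g h := Hom₂.ext (by
    change (α_ (val₁ f) (val₁ g) (val₁ h)).hom = 𝟙 _ ≫ (𝟙 ((val₁ f) ≫ (val₁ g))) ▷ (val₁ h) ≫
      (α_ (val₁ f) (val₁ g) (val₁ h)).hom ≫ (val₁ f) ◁ (𝟙 ((val₁ g) ≫ (val₁ h))) ≫ 𝟙 _; simp)
  map₂_left_unitor {a _} f := Hom₂.ext (by
    change (λ_ (val₁ f)).hom = 𝟙 _ ≫ (𝟙 (𝟙 a.val)) ▷ (val₁ f) ≫ (λ_ (val₁ f)).hom; simp)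
  map₂_right_unitor {_ b} f := Hom₂.ext (by
    change (ρ_ (val₁ f)).hom = 𝟙 _ ≫ (val₁ f) ◁ (𝟙 (𝟙 b.val)) ≫ (ρ_ (val₁ f)).hom; simp)

end LocallyFullSub

/-- The right Kan injectivity class of a class `H` of 1-cells: objects are the right Kan injectives
with respect to all members of `H`, 1-cells preserve the right Kan extensions along members
of `H`. -/
def RInj (H : MorphismProperty K) : LocallyFullSub K where
  obj X := ∀ ⦃A B : K⦄ (f : A ⟶ B), H f → IsRightKanInjective X f
  hom h := ∀ ⦃A B : K⦄ (f : A ⟶ B), H f → PreservesRightKan h f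
  id_mem X _ _ f _ := preservesRightKan_id X f
  comp_mem hf hg _ _ f hH := (hf f hH).comp (hg f hH)

/-- The weak right Kan injectivity class of a class `H` of 1-cells. -/
def WRInj (H : MorphismProperty K) : LocallyFullSub K where
  obj X := ∀ ⦃A B : K⦄ (f : A ⟶ B), H f → IsWeaklyRightKanInjective X f
  hom h := ∀ ⦃A B : K⦄ (f : A ⟶ B), H f → PreservesRightKan h f
  id_mem X _ _ f _ := preservesRightKan_id X f
  comp_mem hf hg _ _ f hH := (hf f hH).comp (hg f hH)

variable {M : Type u₂} [Bicategory.{w₂, v₂} M]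

/-- Given a proarrow equipment `P : K ⥤ᵖ M`, the 2-cell `κ : f ≫ r ⟶ x` is pointwise if `P` takes it
to a right Kan extension in `M`. -/
def IsPointwise (P : Pseudofunctor K M) {A B X : K} (f : A ⟶ B) (x : A ⟶ X) (r : B ⟶ X)
    (κ : f ≫ r ⟶ x) : Prop :=
  IsRightKan (P.map f) (P.map x) (P.map r) ((P.mapComp f r).inv ≫ P.map₂ κ)

/-- The full sub-2-category of `WRInj H` on the objects whose right Kan extensions along members of
`H` are pointwise with respect to the equipment `P`. -/
def WRInjPw (P : Pseudofunctor K M) (H : MorphismProperty K) : LocallyFullSub K where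
  obj X := (WRInj H).obj X ∧ ∀ ⦃A B : K⦄ (f : A ⟶ B), H f →
    ∀ (x : A ⟶ X) (r : B ⟶ X) (κ : f ≫ r ⟶ x), IsRightKan f x r κ → IsPointwise P f x r κ
  hom h := (WRInj H).hom h
  id_mem := (WRInj H).id_mem
  comp_mem := (WRInj H).comp_mem

/-- A pseudofunctor is 2-fully faithful if it induces isomorphisms of hom-categories: bijective on
1-cells and fully faithful on 2-cells. -/
def IsTwoFullyFaithful (F : Pseudofunctor K M) : Prop :=
  ∀ a b : K, Function.Bijective (fun f : a ⟶ b => F.map f) ∧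
    ∀ f g : a ⟶ b, Function.Bijective (fun η : f ⟶ g => F.map₂ η)

/-- A pseudofunctor is a biequivalence if it is essentially surjective on objects, up to equivalence,
and induces equivalences of hom-categories. -/
def IsBiequivalence (F : Pseudofunctor K M) : Prop :=
  (∀ c : M, ∃ b : K, Nonempty (Bicategory.Equivalence (F.obj b) c)) ∧
    ∀ a b : K, (F.mapFunctor a b).IsEquivalence

end TwoCategories

/-! ## The 2-category of topoi -/

/-- A Grothendieck topos: a category equivalent to the category of sheaves of sets on a small
site. -/
def IsGrothendieckTopos (E : Type (u + 1)) [Category.{u} E] : Prop :=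
  ∃ (C : Type u) (_ : SmallCategory C) (J : GrothendieckTopology C),
    Nonempty (CategoryTheory.Equivalence E (Sheaf J (Type u)))

/-- Objects of the 2-category of (Grothendieck) topoi. -/
structure Topos : Type (u + 2) where
  carrier : Type (u + 1)
  [cat : Category.{u} carrier]
  isTopos : IsGrothendieckTopos carrier

attribute [instance] Topos.cat

/-- A geometric morphism: an adjunction `f^* ⊣ f_*` with `f^*` left exact. -/
structure GeomMorphism (E F : Topos.{u}) where
  /-- the direct image `f_*` -/
  dir : E.carrier ⥤ F.carrier
  /-- the inverse image `f^*` -/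
  inv : F.carrier ⥤ E.carrier
  adj : inv ⊣ dir
  lex : PreservesFiniteLimits inv

/-- A 2-cell `f ⟶ g` of topoi is a natural transformation `f^* ⟶ g^*` of inverse images. We also
record its mate `g_* ⟶ f_*`, which is uniquely determined by it. -/
@[ext]
structure GeomTrans {E F : Topos.{u}} (f g : GeomMorphism E F) where
  inv : f.inv ⟶ g.inv
  dir : g.dir ⟶ f.dir
  mate : conjugateEquiv g.adj f.adj inv = dir

namespace GeomTrans

variable {E F : Topos.{u}} {f g : GeomMorphism E F}

theorem ext_inv {η θ : GeomTrans f g} (h : η.inv = θ.inv) : η = θ :=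
  GeomTrans.ext h (by rw [← η.mate, ← θ.mate, h])

theorem ext_dir {η θ : GeomTrans f g} (h : η.dir = θ.dir) : η = θ :=
  ext_inv ((conjugateEquiv g.adj f.adj).injective (by rw [η.mate, θ.mate, h]))

/-- The 2-cell given by a natural transformation of inverse images. -/
def ofInv (α : f.inv ⟶ g.inv) : GeomTrans f g := ⟨α, _, rfl⟩

/-- The 2-cell given by a natural transformation of direct images. -/
def ofDir (β : g.dir ⟶ f.dir) : GeomTrans f g :=
  ⟨(conjugateEquiv g.adj f.adj).symm β, β, Equiv.apply_symm_apply _ _⟩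

end GeomTrans

instance : CategoryStruct Topos.{u} where
  Hom E F := GeomMorphism E F
  id _ := ⟨𝟭 _, 𝟭 _, CategoryTheory.Adjunction.id, inferInstance⟩
  comp f g := ⟨f.dir ⋙ g.dir, g.inv ⋙ f.inv, g.adj.comp f.adj,
    haveI := f.lex; haveI := g.lex; comp_preservesFiniteLimits _ _⟩

/-- The direct image `f_*`. -/
abbrev dirIm {E F : Topos.{u}} (f : E ⟶ F) : E.carrier ⥤ F.carrier := GeomMorphism.dir f

/-- The inverse image `f^*`. -/
abbrev invIm {E F : Topos.{u}} (f : E ⟶ F) : F.carrier ⥤ E.carrier := GeomMorphism.inv f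

instance (E F : Topos.{u}) : Category (E ⟶ F) where
  Hom f g := GeomTrans f g
  id f := ⟨𝟙 _, 𝟙 _, conjugateEquiv_id _⟩
  comp {f g h} η θ := ⟨η.inv ≫ θ.inv, θ.dir ≫ η.dir, by
    rw [← GeomTrans.mate η, ← GeomTrans.mate θ, CategoryTheory.conjugateEquiv_comp]⟩
  id_comp _ := GeomTrans.ext_inv (Category.id_comp _)
  comp_id _ := GeomTrans.ext_inv (Category.comp_id _)
  assoc _ _ _ := GeomTrans.ext_inv (Category.assoc _ _ _)

namespace GeomMorphism

variable {E F G : Topos.{u}}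

/-- An isomorphism of direct images is an invertible 2-cell (in the opposite direction). -/
def isoOfDir {f g : E ⟶ F} (e : g.dir ≅ f.dir) : f ≅ g where
  hom := GeomTrans.ofDir e.hom
  inv := GeomTrans.ofDir e.inv
  hom_inv_id := GeomTrans.ext_dir e.inv_hom_id
  inv_hom_id := GeomTrans.ext_dir e.hom_inv_id

/-- Compatible isomorphisms of inverse and direct images form an invertible 2-cell. -/
def isoMk {f g : E ⟶ F} (e : f.inv ≅ g.inv) (d : g.dir ≅ f.dir)
    (h : conjugateEquiv g.adj f.adj e.hom = d.hom) : f ≅ g where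
  hom := ⟨e.hom, d.hom, h⟩
  inv := ⟨e.inv, d.inv, by
    rw [← cancel_mono d.hom, Iso.inv_hom_id, ← h, conjugateEquiv_comp, Iso.hom_inv_id,
      conjugateEquiv_id]⟩
  hom_inv_id := GeomTrans.ext_inv e.hom_inv_id
  inv_hom_id := GeomTrans.ext_inv e.inv_hom_id

/-- Whiskering on the left. -/
def whiskerL (f : E ⟶ F) {g h : F ⟶ G} (η : g ⟶ h) : f ≫ g ⟶ f ≫ h :=
  GeomTrans.mk (f := f ≫ g) (g := f ≫ h)
    (Functor.whiskerRight η.inv f.inv) (Functor.whiskerLeft f.dir η.dir) (by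
      rw [← η.mate]; exact conjugateEquiv_whiskerRight _ _ _ _)

/-- Whiskering on the right. -/
def whiskerR {f g : E ⟶ F} (η : f ⟶ g) (h : F ⟶ G) : f ≫ h ⟶ g ≫ h :=
  GeomTrans.mk (f := f ≫ h) (g := g ≫ h)
    (Functor.whiskerLeft h.inv η.inv) (Functor.whiskerRight η.dir h.dir) (by
      rw [← η.mate]; exact conjugateEquiv_whiskerLeft _ _ _ _)

/-- The natural transformation of direct images `g_* ⟶ f_*` of a 2-cell `f ⟶ g`. -/
abbrev dir₂ {f g : E ⟶ F} (η : f ⟶ g) : dirIm g ⟶ dirIm f := GeomTrans.dir η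

/-- The natural transformation of inverse images `f^* ⟶ g^*` of a 2-cell `f ⟶ g`. -/
abbrev inv₂ {f g : E ⟶ F} (η : f ⟶ g) : invIm f ⟶ invIm g := GeomTrans.inv η

theorem hom₂_ext {f g : E ⟶ F} {η θ : f ⟶ g} (h : inv₂ η = inv₂ θ) : η = θ :=
  GeomTrans.ext_inv h

theorem hom₂_ext_dir {f g : E ⟶ F} {η θ : f ⟶ g} (h : dir₂ η = dir₂ θ) : η = θ :=
  GeomTrans.ext_dir h

end GeomMorphism

open GeomMorphism in
/-- The 2-category of topoi, geometric morphisms and natural transformations of inverse images. -/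
instance : Bicategory Topos.{u} where
  whiskerLeft f _ _ η := whiskerL f η
  whiskerRight η h := whiskerR η h
  associator f g h := GeomMorphism.isoMk (f := (f ≫ g) ≫ h) (g := f ≫ g ≫ h)
    (Functor.associator h.inv g.inv f.inv).symm (Functor.associator f.dir g.dir h.dir).symm (by
      rw [← cancel_mono (Functor.associator f.dir g.dir h.dir).hom]
      erw [Iso.inv_hom_id]
      erw [← CategoryTheory.conjugateEquiv_associator_hom h.adj g.adj f.adj]
      erw [CategoryTheory.conjugateEquiv_comp]
      erw [Iso.hom_inv_id]
      exact CategoryTheory.conjugateEquiv_id _)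
  leftUnitor f := GeomMorphism.isoMk (f := 𝟙 _ ≫ f) (g := f)
    (Functor.rightUnitor f.inv) (Functor.leftUnitor f.dir).symm
    (CategoryTheory.conjugateEquiv_rightUnitor_hom f.adj)
  rightUnitor f := GeomMorphism.isoMk (f := f ≫ 𝟙 _) (g := f)
    (Functor.leftUnitor f.inv) (Functor.rightUnitor f.dir).symm
    (CategoryTheory.conjugateEquiv_leftUnitor_hom f.adj)
  whiskerLeft_id f g := hom₂_ext (NatTrans.ext (funext fun _ => (invIm f).map_id _))
  whiskerLeft_comp f _ _ _ η θ := hom₂_ext (NatTrans.ext (funext fun _ => (invIm f).map_comp _ _))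
  id_whiskerLeft η := by
    refine hom₂_ext (NatTrans.ext (funext fun X => ?_))
    change (inv₂ η).app X = 𝟙 _ ≫ (inv₂ η).app X ≫ 𝟙 _
    rw [Category.comp_id, Category.id_comp]
  comp_whiskerLeft f g _ _ η := by
    refine hom₂_ext (NatTrans.ext (funext fun X => ?_))
    change (invIm f).map ((invIm g).map ((inv₂ η).app X)) =
      𝟙 _ ≫ (invIm f).map ((invIm g).map ((inv₂ η).app X)) ≫ 𝟙 _
    rw [Category.comp_id, Category.id_comp]
  id_whiskerRight f g := by
    refine hom₂_ext (NatTrans.ext (funext fun X => ?_))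
    rfl
  comp_whiskerRight η θ h := by
    refine hom₂_ext (NatTrans.ext (funext fun X => ?_))
    rfl
  whiskerRight_id η := by
    refine hom₂_ext (NatTrans.ext (funext fun X => ?_))
    change (inv₂ η).app X = 𝟙 _ ≫ (inv₂ η).app X ≫ 𝟙 _
    rw [Category.comp_id, Category.id_comp]
  whiskerRight_comp η g h := by
    refine hom₂_ext (NatTrans.ext (funext fun X => ?_))
    change (inv₂ η).app ((invIm g).obj ((invIm h).obj X)) =
      𝟙 _ ≫ (inv₂ η).app ((invIm g).obj ((invIm h).obj X)) ≫ 𝟙 _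
    rw [Category.comp_id, Category.id_comp]
  whisker_assoc f _ _ η h := by
    refine hom₂_ext (NatTrans.ext (funext fun X => ?_))
    change (invIm f).map ((inv₂ η).app ((invIm h).obj X)) =
      𝟙 _ ≫ (invIm f).map ((inv₂ η).app ((invIm h).obj X)) ≫ 𝟙 _
    rw [Category.comp_id, Category.id_comp]
  whisker_exchange η θ := hom₂_ext (NatTrans.ext (funext fun X =>
    (inv₂ η).naturality ((inv₂ θ).app X)))
  pentagon {a _ _ _ _} f g h i := by
    refine hom₂_ext (NatTrans.ext (funext fun X => ?_))
    change 𝟙 _ ≫ 𝟙 _ ≫ (invIm f).map (𝟙 _) = 𝟙 _ ≫ 𝟙 _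
    rw [CategoryTheory.Functor.map_id, Category.id_comp]
  triangle f g := by
    refine hom₂_ext (NatTrans.ext (funext fun X => ?_))
    change 𝟙 _ ≫ (invIm f).map (𝟙 _) = 𝟙 _
    rw [CategoryTheory.Functor.map_id]; exact Category.comp_id _

/-- Objects of the 2-category of topoi and left exact functors, with the 2-cells reversed (the full
sub-2-category on topoi of the 2-cell dual of the 2-category of left exact categories). -/
structure ToposLexCo : Type (u + 2) where
  topos : Topos.{u}

namespace ToposLexCo

/-- The 1-cells: left exact functors. -/
structure Hom (E F : ToposLexCo.{u}) where
  functor : E.topos.carrier ⥤ F.topos.carrier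
  lex : PreservesFiniteLimits functor

/-- The 2-cells `f ⟶ g`: natural transformations from `g` to `f`. -/
@[ext]
structure Hom₂ {E F : ToposLexCo.{u}} (f g : Hom E F) where
  nat : g.functor ⟶ f.functor

instance : CategoryStruct ToposLexCo.{u} where
  Hom E F := Hom E F
  id _ := ⟨𝟭 _, inferInstance⟩
  comp f g := ⟨f.functor ⋙ g.functor,
    haveI := f.lex; haveI := g.lex; comp_preservesFiniteLimits _ _⟩

instance (E F : ToposLexCo.{u}) : Category (E ⟶ F) where
  Hom f g := Hom₂ f g
  id _ := ⟨𝟙 _⟩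
  comp η θ := ⟨θ.nat ≫ η.nat⟩
  id_comp _ := Hom₂.ext (Category.comp_id _)
  comp_id _ := Hom₂.ext (Category.id_comp _)
  assoc _ _ _ := Hom₂.ext (Category.assoc _ _ _).symm

/-- The functor underlying a 1-cell. -/
abbrev fn {E F : ToposLexCo.{u}} (f : E ⟶ F) : E.topos.carrier ⥤ F.topos.carrier := Hom.functor f

/-- The natural transformation underlying a 2-cell (in the opposite direction). -/
abbrev nt {E F : ToposLexCo.{u}} {f g : E ⟶ F} (η : f ⟶ g) : fn g ⟶ fn f := Hom₂.nat η

/-- A natural isomorphism is an invertible 2-cell. -/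
def isoMk {E F : ToposLexCo.{u}} {f g : E ⟶ F} (e : fn f ≅ fn g) : f ≅ g where
  hom := ⟨e.inv⟩
  inv := ⟨e.hom⟩
  hom_inv_id := Hom₂.ext e.hom_inv_id
  inv_hom_id := Hom₂.ext e.inv_hom_id

theorem hom₂_ext {E F : ToposLexCo.{u}} {f g : E ⟶ F} {η θ : f ⟶ g}
    (h : ∀ X, (nt η).app X = (nt θ).app X) : η = θ :=
  Hom₂.ext (NatTrans.ext (funext h))

/-- Whiskering on the left. -/
def whiskerL {E F G : ToposLexCo.{u}} (f : E ⟶ F) {g h : F ⟶ G} (η : g ⟶ h) :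
    f ≫ g ⟶ f ≫ h :=
  Hom₂.mk (f := f ≫ g) (g := f ≫ h) (Functor.whiskerLeft (fn f) (nt η))

/-- Whiskering on the right. -/
def whiskerR {E F G : ToposLexCo.{u}} {f g : E ⟶ F} (η : f ⟶ g) (h : F ⟶ G) :
    f ≫ h ⟶ g ≫ h :=
  Hom₂.mk (f := f ≫ h) (g := g ≫ h) (Functor.whiskerRight (nt η) (fn h))

/-- The 2-category of topoi, left exact functors, and natural transformations with their direction
reversed. -/
instance : Bicategory ToposLexCo.{u} where
  whiskerLeft f _ _ η := whiskerL f η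
  whiskerRight η h := whiskerR η h
  associator f g h := isoMk (f := (f ≫ g) ≫ h) (g := f ≫ g ≫ h)
    (Functor.associator (fn f) (fn g) (fn h))
  leftUnitor f := isoMk (f := 𝟙 _ ≫ f) (g := f) (Functor.leftUnitor (fn f))
  rightUnitor f := isoMk (f := f ≫ 𝟙 _) (g := f) (Functor.rightUnitor (fn f))
  whiskerLeft_id f g := hom₂_ext fun _ => rfl
  whiskerLeft_comp f _ _ _ η θ := hom₂_ext fun _ => rfl
  id_whiskerLeft η := by
    refine hom₂_ext fun X => ?_
    change (nt η).app X = (𝟙 _ ≫ (nt η).app X) ≫ 𝟙 _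
    rw [Category.comp_id, Category.id_comp]
  comp_whiskerLeft f g _ _ η := by
    refine hom₂_ext fun X => ?_
    change (nt η).app ((fn g).obj ((fn f).obj X)) =
      (𝟙 _ ≫ (nt η).app ((fn g).obj ((fn f).obj X))) ≫ 𝟙 _
    rw [Category.comp_id, Category.id_comp]
  id_whiskerRight f g := hom₂_ext fun _ => (fn g).map_id _
  comp_whiskerRight η θ h := hom₂_ext fun _ => (fn h).map_comp _ _
  whiskerRight_id η := by
    refine hom₂_ext fun X => ?_
    change (nt η).app X = (𝟙 _ ≫ (nt η).app X) ≫ 𝟙 _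
    rw [Category.comp_id, Category.id_comp]
  whiskerRight_comp η g h := by
    refine hom₂_ext fun X => ?_
    change (fn h).map ((fn g).map ((nt η).app X)) =
      (𝟙 _ ≫ (fn h).map ((fn g).map ((nt η).app X))) ≫ 𝟙 _
    rw [Category.comp_id, Category.id_comp]
  whisker_assoc f _ _ η h := by
    refine hom₂_ext fun X => ?_
    change (fn h).map ((nt η).app ((fn f).obj X)) =
      (𝟙 _ ≫ (fn h).map ((nt η).app ((fn f).obj X))) ≫ 𝟙 _
    rw [Category.comp_id, Category.id_comp]
  whisker_exchange η θ := by
    refine hom₂_ext fun X => ?_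
    exact (nt θ).naturality ((nt η).app X)
  pentagon f g h i := by
    refine hom₂_ext fun X => ?_
    change (𝟙 _ ≫ 𝟙 _) ≫ (fn i).map (𝟙 _) = 𝟙 _ ≫ 𝟙 _
    rw [CategoryTheory.Functor.map_id]; exact Category.comp_id _
  triangle f g := by
    refine hom₂_ext fun X => ?_
    change 𝟙 _ ≫ 𝟙 _ = (fn g).map (𝟙 _)
    rw [CategoryTheory.Functor.map_id]; exact Category.comp_id _

end ToposLexCo

theorem dirIm_lex {E F : Topos.{u}} (f : E ⟶ F) : PreservesFiniteLimits (dirIm f) := by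
  have := (GeomMorphism.adj f).rightAdjoint_preservesLimits.{0, 0}
  infer_instance

open GeomMorphism in
/-- The proarrow equipment `(-)_*` on topoi, which takes a geometric morphism to its direct image
(and a 2-cell to its mate). -/
def directImage : Pseudofunctor Topos.{u} ToposLexCo.{u} where
  obj E := ⟨E⟩
  map {E F} f := ToposLexCo.Hom.mk (E := ⟨E⟩) (F := ⟨F⟩) (dirIm (E := E) (F := F) f) (dirIm_lex f)
  map₂ {E F f g} η := ToposLexCo.Hom₂.mk (E := ⟨E⟩) (F := ⟨F⟩) (f := ⟨dirIm (E := E) (F := F) f, dirIm_lex f⟩)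
    (g := ⟨dirIm (E := E) (F := F) g, dirIm_lex g⟩) (dir₂ η)
  map₂_id _ := rfl
  map₂_comp _ _ := rfl
  mapId E := Iso.refl _
  mapComp f g := Iso.refl _
  map₂_whisker_left f _ _ η := by
    refine ToposLexCo.hom₂_ext fun X => ?_
    change (dir₂ η).app ((dirIm f).obj X) = (𝟙 _ ≫ (dir₂ η).app ((dirIm f).obj X)) ≫ 𝟙 _
    rw [Category.comp_id, Category.id_comp]
  map₂_whisker_right η h := by
    refine ToposLexCo.hom₂_ext fun X => ?_
    change (dirIm h).map ((dir₂ η).app X) = (𝟙 _ ≫ (dirIm h).map ((dir₂ η).app X)) ≫ 𝟙 _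
    rw [Category.comp_id, Category.id_comp]
  map₂_associator f g h := by
    refine ToposLexCo.hom₂_ext fun X => ?_
    change 𝟙 _ = (((𝟙 _ ≫ 𝟙 _) ≫ 𝟙 _) ≫ (dirIm h).map (𝟙 _)) ≫ 𝟙 _
    simp only [CategoryTheory.Functor.map_id, Category.comp_id]
  map₂_left_unitor f := by
    refine ToposLexCo.hom₂_ext fun X => ?_
    change 𝟙 _ = (𝟙 _ ≫ (dirIm f).map (𝟙 _)) ≫ 𝟙 _
    simp only [CategoryTheory.Functor.map_id, Category.comp_id]
  map₂_right_unitor f := by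
    refine ToposLexCo.hom₂_ext fun X => ?_
    change 𝟙 _ = (𝟙 _ ≫ 𝟙 _) ≫ 𝟙 _
    simp only [Category.comp_id]

/-! ## Classes of geometric morphisms -/

/-- The class of all geometric morphisms. -/
def allGeom : MorphismProperty Topos.{u} := fun _ _ _ => True

/-- The class of geometric embeddings: the direct image is fully faithful. -/
def embeddings : MorphismProperty Topos.{u} :=
  fun _ _ f => (dirIm f).Full ∧ (dirIm f).Faithful

/-- A geometric morphism is ethereal if its direct image preserves all (small) colimits. -/
def IsEthereal {E F : Topos.{u}} (f : E ⟶ F) : Prop :=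
  PreservesColimitsOfSize.{u, u} (dirIm f)

/-- A topos is free if it is equivalent to the presheaf topos on a small left exact category. -/
def IsFree (E : Topos.{u}) : Prop :=
  ∃ (C : Type u) (_ : SmallCategory C) (_ : HasFiniteLimits C),
    Nonempty (CategoryTheory.Equivalence E.carrier (Cᵒᵖ ⥤ Type u))

/-- The locally full sub-2-category of free topoi and ethereal geometric morphisms. -/
def FreeTopoi : LocallyFullSub Topos.{u} where
  obj := IsFree
  hom := IsEthereal
  id_mem E := by
    change PreservesColimitsOfSize.{u, u} (𝟭 E.carrier)
    infer_instance
  comp_mem {a b c f g} hf hg := by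
    have h₁ : PreservesColimitsOfSize.{u, u} (dirIm f) := hf
    have h₂ : PreservesColimitsOfSize.{u, u} (dirIm g) := hg
    change PreservesColimitsOfSize.{u, u} (dirIm f ⋙ dirIm g)
    infer_instance

/-! ## The 2-category of small left exact categories -/

/-- A small category with finite limits. -/
structure LexCat : Type (u + 1) where
  carrier : Type u
  [cat : SmallCategory carrier]
  [lim : HasFiniteLimits carrier]

attribute [instance] LexCat.cat LexCat.lim

namespace LexCat

/-- The 1-cells: left exact functors. -/
structure Hom (C D : LexCat.{u}) where
  functor : C.carrier ⥤ D.carrier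
  lex : PreservesFiniteLimits functor

/-- The 2-cells: natural transformations. -/
@[ext]
structure Hom₂ {C D : LexCat.{u}} (f g : Hom C D) where
  nat : f.functor ⟶ g.functor

instance : CategoryStruct LexCat.{u} where
  Hom C D := Hom C D
  id _ := ⟨𝟭 _, inferInstance⟩
  comp f g := ⟨f.functor ⋙ g.functor,
    haveI := f.lex; haveI := g.lex; comp_preservesFiniteLimits _ _⟩

instance (C D : LexCat.{u}) : Category (C ⟶ D) where
  Hom f g := Hom₂ f g
  id _ := ⟨𝟙 _⟩
  comp η θ := ⟨η.nat ≫ θ.nat⟩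
  id_comp _ := Hom₂.ext (Category.id_comp _)
  comp_id _ := Hom₂.ext (Category.comp_id _)
  assoc _ _ _ := Hom₂.ext (Category.assoc _ _ _)

/-- The functor underlying a 1-cell. -/
abbrev fn {C D : LexCat.{u}} (f : C ⟶ D) : C.carrier ⥤ D.carrier := Hom.functor f

theorem fn_lex {C D : LexCat.{u}} (f : C ⟶ D) : PreservesFiniteLimits (fn f) := Hom.lex f

/-- The natural transformation underlying a 2-cell. -/
abbrev nt {C D : LexCat.{u}} {f g : C ⟶ D} (η : f ⟶ g) : fn f ⟶ fn g := Hom₂.nat η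

/-- A natural isomorphism is an invertible 2-cell. -/
def isoMk {C D : LexCat.{u}} {f g : C ⟶ D} (e : fn f ≅ fn g) : f ≅ g where
  hom := ⟨e.hom⟩
  inv := ⟨e.inv⟩
  hom_inv_id := Hom₂.ext e.hom_inv_id
  inv_hom_id := Hom₂.ext e.inv_hom_id

theorem hom₂_ext {C D : LexCat.{u}} {f g : C ⟶ D} {η θ : f ⟶ g}
    (h : ∀ X, (nt η).app X = (nt θ).app X) : η = θ :=
  Hom₂.ext (NatTrans.ext (funext h))

/-- Whiskering on the left. -/
def whiskerL {C D E : LexCat.{u}} (f : C ⟶ D) {g h : D ⟶ E} (η : g ⟶ h) : f ≫ g ⟶ f ≫ h :=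
  Hom₂.mk (f := f ≫ g) (g := f ≫ h) (Functor.whiskerLeft (fn f) (nt η))

/-- Whiskering on the right. -/
def whiskerR {C D E : LexCat.{u}} {f g : C ⟶ D} (η : f ⟶ g) (h : D ⟶ E) : f ≫ h ⟶ g ≫ h :=
  Hom₂.mk (f := f ≫ h) (g := g ≫ h) (Functor.whiskerRight (nt η) (fn h))

/-- The 2-category of small left exact categories, left exact functors and natural
transformations. -/
instance : Bicategory LexCat.{u} where
  whiskerLeft f _ _ η := whiskerL f η
  whiskerRight η h := whiskerR η h
  associator f g h := isoMk (f := (f ≫ g) ≫ h) (g := f ≫ g ≫ h)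
    (Functor.associator (fn f) (fn g) (fn h))
  leftUnitor f := isoMk (f := 𝟙 _ ≫ f) (g := f) (Functor.leftUnitor (fn f))
  rightUnitor f := isoMk (f := f ≫ 𝟙 _) (g := f) (Functor.rightUnitor (fn f))
  whiskerLeft_id f g := hom₂_ext fun _ => rfl
  whiskerLeft_comp f _ _ _ η θ := hom₂_ext fun _ => rfl
  id_whiskerLeft η := by
    refine hom₂_ext fun X => ?_
    change (nt η).app X = 𝟙 _ ≫ (nt η).app X ≫ 𝟙 _
    rw [Category.comp_id, Category.id_comp]
  comp_whiskerLeft f g _ _ η := by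
    refine hom₂_ext fun X => ?_
    change (nt η).app ((fn g).obj ((fn f).obj X)) =
      𝟙 _ ≫ (nt η).app ((fn g).obj ((fn f).obj X)) ≫ 𝟙 _
    rw [Category.comp_id, Category.id_comp]
  id_whiskerRight f g := hom₂_ext fun _ => (fn g).map_id _
  comp_whiskerRight η θ h := hom₂_ext fun _ => (fn h).map_comp _ _
  whiskerRight_id η := by
    refine hom₂_ext fun X => ?_
    change (nt η).app X = 𝟙 _ ≫ (nt η).app X ≫ 𝟙 _
    rw [Category.comp_id, Category.id_comp]
  whiskerRight_comp η g h := by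
    refine hom₂_ext fun X => ?_
    change (fn h).map ((fn g).map ((nt η).app X)) =
      𝟙 _ ≫ (fn h).map ((fn g).map ((nt η).app X)) ≫ 𝟙 _
    rw [Category.comp_id, Category.id_comp]
  whisker_assoc f _ _ η h := by
    refine hom₂_ext fun X => ?_
    change (fn h).map ((nt η).app ((fn f).obj X)) =
      𝟙 _ ≫ (fn h).map ((nt η).app ((fn f).obj X)) ≫ 𝟙 _
    rw [Category.comp_id, Category.id_comp]
  whisker_exchange η θ := by
    refine hom₂_ext fun X => ?_
    exact ((nt θ).naturality ((nt η).app X)).symm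
  pentagon f g h i := by
    refine hom₂_ext fun X => ?_
    change (fn i).map (𝟙 _) ≫ 𝟙 _ ≫ 𝟙 _ = 𝟙 _ ≫ 𝟙 _
    rw [CategoryTheory.Functor.map_id, Category.id_comp]
  triangle f g := by
    refine hom₂_ext fun X => ?_
    change 𝟙 _ ≫ 𝟙 _ = (fn g).map (𝟙 _)
    rw [CategoryTheory.Functor.map_id]; exact Category.comp_id _

end LexCat

/-! ## The presheaf construction -/

/-- The topos of presheaves on a small category. -/
def pshTopos (C : Type u) [SmallCategory C] : Topos.{u} where
  carrier := Cᵒᵖ ⥤ Type u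
  isTopos := ⟨C, inferInstance, ⊥, ⟨(sheafBotEquivalence (Type u)).symm⟩⟩

/-- The geometric morphism `Psh C ⟶ Psh D` induced by a left exact functor `F : D ⥤ C`: its direct
image is restriction along `F`, its inverse image is left Kan extension along `F`. -/
def pshGeom {C D : LexCat.{u}} (F : D ⟶ C) : pshTopos C.carrier ⟶ pshTopos D.carrier :=
  GeomMorphism.mk (E := pshTopos C.carrier) (F := pshTopos D.carrier)
    ((Functor.whiskeringLeft _ _ (Type u)).obj (LexCat.fn F).op)
    (LexCat.fn F).op.lan ((LexCat.fn F).op.lanAdjunction (Type u))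
    (haveI := LexCat.fn_lex F; inferInstanceAs (PreservesFiniteLimits (LexCat.fn F).op.lan))

theorem pshGeom_isEthereal {C D : LexCat.{u}} (F : D ⟶ C) : IsEthereal (pshGeom F) :=
  inferInstanceAs (PreservesColimitsOfSize.{u, u}
    ((Functor.whiskeringLeft _ _ (Type u)).obj (LexCat.fn F).op))

theorem pshTopos_isFree (C : LexCat.{u}) : IsFree (pshTopos C.carrier) :=
  ⟨C.carrier, inferInstance, inferInstance, ⟨CategoryTheory.Equivalence.refl⟩⟩

/-- The 2-cell induced by a natural transformation `η : F ⟶ G` of left exact functors: on direct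
images it is restriction along `η`. -/
def pshTrans {C D : LexCat.{u}} {F G : D ⟶ C} (η : F ⟶ G) : pshGeom F ⟶ pshGeom G :=
  GeomTrans.ofDir (f := pshGeom F) (g := pshGeom G)
    ((Functor.whiskeringLeft _ _ (Type u)).map (NatTrans.op (LexCat.nt η)))

/-- `Psh` preserves identities. -/
def pshId (C : LexCat.{u}) : pshGeom (𝟙 C) ≅ 𝟙 (pshTopos C.carrier) :=
  GeomMorphism.isoOfDir (f := pshGeom (𝟙 C)) (g := 𝟙 (pshTopos C.carrier))
    (NatIso.ofComponents (F := 𝟭 (C.carrierᵒᵖ ⥤ Type u))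
      (G := (Functor.whiskeringLeft _ _ (Type u)).obj (𝟭 C.carrier).op)
      fun P => NatIso.ofComponents (fun X => Iso.refl (P.obj X)))

/-- `Psh` preserves composition. -/
def pshComp {C D E : LexCat.{u}} (F : D ⟶ C) (G : E ⟶ D) :
    pshGeom (G ≫ F) ≅ pshGeom F ≫ pshGeom G :=
  GeomMorphism.isoOfDir (f := pshGeom (G ≫ F)) (g := pshGeom F ≫ pshGeom G)
    (NatIso.ofComponents
      (F := (Functor.whiskeringLeft _ _ (Type u)).obj (LexCat.fn F).op ⋙
        (Functor.whiskeringLeft _ _ (Type u)).obj (LexCat.fn G).op)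
      (G := (Functor.whiskeringLeft _ _ (Type u)).obj (LexCat.fn G ⋙ LexCat.fn F).op)
      fun P => NatIso.ofComponents
        (fun X => Iso.refl (P.obj ((LexCat.fn F).op.obj ((LexCat.fn G).op.obj X)))))

theorem free_hom₂_ext {E F : FreeTopoi.{u}.Obj} {f g : E ⟶ F} {η θ : f ⟶ g}
    (h : ∀ P, (GeomMorphism.dir₂ (LocallyFullSub.val₂ η)).app P =
      (GeomMorphism.dir₂ (LocallyFullSub.val₂ θ)).app P) : η = θ :=
  LocallyFullSub.Hom₂.ext (GeomMorphism.hom₂_ext_dir (NatTrans.ext (funext h)))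

/-- The free topos of presheaves on a small left exact category. -/
def freePsh (C : LexCat.{u}) : FreeTopoi.{u}.Obj := ⟨pshTopos C.carrier, pshTopos_isFree C⟩

/-- The ethereal geometric morphism induced by a left exact functor. -/
def freePshMap {C D : LexCat.{u}} (F : D ⟶ C) : freePsh C ⟶ freePsh D :=
  LocallyFullSub.Hom.mk (a := freePsh C) (b := freePsh D) (pshGeom F) (pshGeom_isEthereal F)

/-- The 2-cell induced by a natural transformation. -/
def freePshMap₂ {C D : LexCat.{u}} {F G : D ⟶ C} (η : F ⟶ G) : freePshMap F ⟶ freePshMap G :=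
  LocallyFullSub.Hom₂.mk (a := freePsh C) (b := freePsh D) (pshTrans η)

theorem freePsh_hom₂_ext {C D : LexCat.{u}} {f g : freePsh C ⟶ freePsh D} {η θ : f ⟶ g}
    (h : ∀ (P : C.carrierᵒᵖ ⥤ Type u) (X : D.carrierᵒᵖ),
      NatTrans.app (C := D.carrierᵒᵖ) (D := Type u)
        ((GeomMorphism.dir₂ (LocallyFullSub.val₂ η)).app P) X =
      NatTrans.app (C := D.carrierᵒᵖ) (D := Type u)
        ((GeomMorphism.dir₂ (LocallyFullSub.val₂ θ)).app P) X) : η = θ :=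
  free_hom₂_ext fun P => NatTrans.ext (C := D.carrierᵒᵖ) (D := Type u) (funext fun X => h P X)

/-- The presheaf construction, as a pseudofunctor from the 1-cell dual of the 2-category of small
left exact categories to the 2-category of free topoi and ethereal geometric morphisms. -/
def psh : Pseudofunctor LexCat.{u}ᵒᵖ FreeTopoi.{u}.Obj where
  obj C := freePsh C.unop
  map F := freePshMap F.unop
  map₂ η := freePshMap₂ (Bicategory.Opposite.Hom2.unop2 η)
  map₂_id {C D} F := by
    refine freePsh_hom₂_ext (C := C.unop) (D := D.unop) fun P X => ?_
    exact P.map_id _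
  map₂_comp {C D _ _ _} η θ := by
    refine freePsh_hom₂_ext (C := C.unop) (D := D.unop) fun P X => ?_
    exact P.map_comp _ _
  mapId C := LocallyFullSub.isoMk (pshId C.unop)
  mapComp F G := LocallyFullSub.isoMk (pshComp F.unop G.unop)
  map₂_whisker_left {C D E} F G H η := by
    refine freePsh_hom₂_ext (C := C.unop) (D := E.unop) fun P X => ?_
    change P.map ((LexCat.fn F.unop).map
      ((LexCat.nt (Bicategory.Opposite.Hom2.unop2 η)).app X.unop)).op =
        (𝟙 _ ≫ P.map ((LexCat.fn F.unop).map
          ((LexCat.nt (Bicategory.Opposite.Hom2.unop2 η)).app X.unop)).op) ≫ 𝟙 _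
    rw [Category.comp_id, Category.id_comp]
  map₂_whisker_right {C D E _ _} η H := by
    refine freePsh_hom₂_ext (C := C.unop) (D := E.unop) fun P X => ?_
    change P.map ((LexCat.nt (Bicategory.Opposite.Hom2.unop2 η)).app
        ((LexCat.fn H.unop).obj X.unop)).op =
      (𝟙 _ ≫ P.map ((LexCat.nt (Bicategory.Opposite.Hom2.unop2 η)).app
        ((LexCat.fn H.unop).obj X.unop)).op) ≫ 𝟙 _
    rw [Category.comp_id, Category.id_comp]
  map₂_associator {A B C D} F G H := by
    refine freePsh_hom₂_ext (C := A.unop) (D := D.unop) fun P X => ?_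
    change P.map (𝟙 _) = (((𝟙 _ ≫ 𝟙 _) ≫ 𝟙 _) ≫ 𝟙 _) ≫ 𝟙 _
    simp only [CategoryTheory.Functor.map_id, Category.comp_id]
  map₂_left_unitor {A B} F := by
    refine freePsh_hom₂_ext (C := A.unop) (D := B.unop) fun P X => ?_
    change P.map (𝟙 _) = (𝟙 _ ≫ 𝟙 _) ≫ 𝟙 _
    simp only [CategoryTheory.Functor.map_id, Category.comp_id]
  map₂_right_unitor {A B} F := by
    refine freePsh_hom₂_ext (C := A.unop) (D := B.unop) fun P X => ?_
    change P.map (𝟙 _) = (𝟙 _ ≫ 𝟙 _) ≫ 𝟙 _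
    simp only [CategoryTheory.Functor.map_id, Category.comp_id]

end

end KanTopoi

/-! A 2-cell `f ≫ y ⟶ x` of topoi transposes to a natural transformation `y^* ⟶ f_* x^*`. A right
Kan extension of `x` along `f` is therefore a universal approximation of `f_* x^*` by an inverse
image functor. When the target is `Psh C` with `C` left exact, `f_* x^*` is left exact but usually
not cocontinuous. The cocontinuous extension of its restriction to representables is again left
exact (Diaconescu, `IsGrothendieckTopos.lex_of_yoneda_comp_lex`), hence an inverse image `r^*`, and
it comes with a map `γ : r^* ⟶ f_* x^*` invertible on representables. That invertibility alone makes
`r` a right Kan extension, makes it pointwise (`exists_unique_desc_of_isIso_yoneda`), and makes the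
counit invertible when `f` is an embedding. So free topoi have both injectivity properties.

Injectivity for embeddings passes to arbitrary retracts because idempotent 2-cells of topoi split
(`IsRetract.exists_isRightKan`). Pointwise weak injectivity passes to coadjoint retracts because
right adjoints preserve Kan extensions.

Conversely, every topos `E` has an embedding `s : E ⟶ Psh D` given by a small dense full subcategory
`D` closed under finite limits. Extending the identity of `E` along `s` gives `r`, and it must be
shown that `r^* ⊣ s^*`. In the pointwise case, `r_*` and `s^*` are both left Kan extensions of the
identity along `s_*`, hence isomorphic. In the case of invertible counits, the unit and counit are
constructed by hand and the triangles follow from density and from uniqueness of factorisations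
(`nonempty_adjunction_of_reflection`).

The direct image `h_*` is always left exact, so if it is cocontinuous it is itself an inverse image.
Thus ethereal means having a left adjoint in `Topos`. Such 1-cells preserve right Kan extensions,
and a 1-cell `h` that preserves the extension of the identity along `h` has that extension as left
adjoint. Finally, if `R` is a cocontinuous direct image between presheaf topoi, its left adjoint
sends representables to retracts of representables. These are representable because idempotents
split in a left exact category, so `R` is restriction along a left exact functor. This gives the
biequivalence. -/

namespace KanTopoi

open CategoryTheory CategoryTheory.Limits Opposite
open scoped CategoryTheory.Bicategory

noncomputable section

/-! ## Yoneda extensions -/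

section YonedaExtension

variable {C : Type u} [SmallCategory C] {E : Type (u + 1)} [Category.{u} E]

/-- The restricted Yoneda functor of a functor out of a small category. -/
abbrev nerve (F : C ⥤ E) : E ⥤ Cᵒᵖ ⥤ Type u :=
  yoneda ⋙ (Functor.whiskeringLeft _ _ (Type u)).obj F.op

/-- The restricted Yoneda functor, up to universe lifting. -/
def restrictedULiftYonedaIsoNerve (F : C ⥤ E) :
    Presheaf.restrictedULiftYoneda.{u} F ≅ nerve F :=
  Functor.isoWhiskerRight uliftYonedaIsoYoneda.{u} ((Functor.whiskeringLeft _ _ (Type u)).obj F.op)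

variable [HasColimitsOfSize.{u, u} E]

/-- The cocontinuous extension of a functor along the Yoneda embedding. -/
def yonedaExt (F : C ⥤ E) : (Cᵒᵖ ⥤ Type u) ⥤ E :=
  uliftYoneda.{u}.leftKanExtension F

/-- The cocontinuous extension is left adjoint to the restricted Yoneda functor. -/
def yonedaExtAdjunction (F : C ⥤ E) : yonedaExt F ⊣ nerve F :=
  (Presheaf.uliftYonedaAdjunction.{u} (uliftYoneda.{u}.leftKanExtension F)
    (uliftYoneda.{u}.leftKanExtensionUnit F)).ofNatIsoRight (restrictedULiftYonedaIsoNerve F)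

/-- The cocontinuous extension extends the given functor. -/
def yonedaCompYonedaExt (F : C ⥤ E) : yoneda ⋙ yonedaExt F ≅ F :=
  Functor.isoWhiskerRight uliftYonedaIsoYoneda.{u}.symm _ ≪≫
    Presheaf.isExtensionAlongULiftYoneda.{u} F

instance (F : C ⥤ E) : PreservesColimitsOfSize.{u, u} (yonedaExt F) :=
  (yonedaExtAdjunction F).leftAdjoint_preservesColimits

end YonedaExtension

section Cocontinuous

variable {C : Type u} [SmallCategory C] {E : Type*} [Category* E]

/-- A cocontinuous functor on presheaves is the left Kan extension of its restriction along the
Yoneda embedding. -/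
instance isLeftKanExtension_of_cocontinuous (L : (Cᵒᵖ ⥤ Type u) ⥤ E)
    [PreservesColimitsOfSize.{u, u} L] :
    L.IsLeftKanExtension (𝟙 (yoneda ⋙ L)) := by
  refine Functor.LeftExtension.IsPointwiseLeftKanExtension.isLeftKanExtension
    (E := Functor.LeftExtension.mk L (𝟙 (yoneda ⋙ L))) fun P => ?_
  -- Every presheaf is the colimit of the representables over it, and `L` carries this colimit
  -- cocone to the cocone required for a pointwise extension.
  refine (isColimitOfPreserves L (Presheaf.isColimitTautologicalCocone P)).ofIsoColimit
    (Cocone.ext (Iso.refl _) fun j => ?_)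
  change L.map j.hom ≫ 𝟙 _ = 𝟙 _ ≫ L.map j.hom
  rw [Category.comp_id, Category.id_comp]

theorem cocontinuous_hom_ext {L G : (Cᵒᵖ ⥤ Type u) ⥤ E} [PreservesColimitsOfSize.{u, u} L]
    {α β : L ⟶ G} (h : ∀ c : C, α.app (yoneda.obj c) = β.app (yoneda.obj c)) : α = β :=
  L.hom_ext_of_isLeftKanExtension (𝟙 (yoneda ⋙ L)) _ _ (by ext c; simpa using h c)

theorem cocontinuous_exists_hom {L G : (Cᵒᵖ ⥤ Type u) ⥤ E} [PreservesColimitsOfSize.{u, u} L]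
    (φ : yoneda ⋙ L ⟶ yoneda ⋙ G) :
    ∃ α : L ⟶ G, ∀ c : C, α.app (yoneda.obj c) = φ.app c := by
  refine ⟨L.descOfIsLeftKanExtension (𝟙 (yoneda ⋙ L)) G φ, fun c => ?_⟩
  have := NatTrans.congr_app (L.descOfIsLeftKanExtension_fac (𝟙 (yoneda ⋙ L)) G φ) c
  simpa using this

/-- Cocontinuous functors on presheaves which agree on representables are isomorphic. -/
theorem cocontinuous_exists_iso {L G : (Cᵒᵖ ⥤ Type u) ⥤ E} [PreservesColimitsOfSize.{u, u} L]
    [PreservesColimitsOfSize.{u, u} G] (φ : yoneda ⋙ L ≅ yoneda ⋙ G) :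
    ∃ α : L ≅ G, ∀ c : C, α.hom.app (yoneda.obj c) = φ.hom.app c := by
  obtain ⟨α, hα⟩ := cocontinuous_exists_hom φ.hom
  obtain ⟨β, hβ⟩ := cocontinuous_exists_hom φ.inv
  exact ⟨⟨α, β, cocontinuous_hom_ext fun c => by simp [hα, hβ],
    cocontinuous_hom_ext fun c => by simp [hα, hβ]⟩, hα⟩

end Cocontinuous

/-! ## Retracts of functors -/

section Retracts

variable {C D : Type*} [Category* C] [Category* D] {F G : C ⥤ D}

/-- A cocone under `K ⋙ G` becomes one under `K ⋙ F` through `p`; its descent precomposed with `i`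
is the descent for `G`. Together with its dual below, this shows that a retract of an inverse image
functor is again left exact and cocontinuous. -/
theorem preservesColimit_of_retract {J : Type*} [Category* J] {K : J ⥤ C} (i : G ⟶ F) (p : F ⟶ G)
    (h : i ≫ p = 𝟙 G) [PreservesColimit K F] : PreservesColimit K G where
  preserves {c} hc := by
    have h' : ∀ X, i.app X ≫ p.app X = 𝟙 _ := fun X => NatTrans.congr_app h X
    have hF := isColimitOfPreserves F hc
    refine ⟨⟨fun s => i.app _ ≫ hF.desc ⟨s.pt, Functor.whiskerLeft K p ≫ s.ι⟩, fun s j => ?_,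
      fun s m hm => ?_⟩⟩
    · have := hF.fac ⟨s.pt, Functor.whiskerLeft K p ≫ s.ι⟩ j
      dsimp at this ⊢
      rw [i.naturality_assoc, this, reassoc_of% h']
    · have : hF.desc ⟨s.pt, Functor.whiskerLeft K p ≫ s.ι⟩ = p.app _ ≫ m := by
        refine hF.hom_ext fun j => ?_
        rw [hF.fac]
        dsimp at hm ⊢
        rw [← hm, p.naturality_assoc]
      rw [this, reassoc_of% h']

theorem preservesLimit_of_retract {J : Type*} [Category* J] {K : J ⥤ C} (i : G ⟶ F) (p : F ⟶ G)
    (h : i ≫ p = 𝟙 G) [PreservesLimit K F] : PreservesLimit K G where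
  preserves {c} hc := by
    have h' : ∀ X, i.app X ≫ p.app X = 𝟙 _ := fun X => NatTrans.congr_app h X
    have hF := isLimitOfPreserves F hc
    refine ⟨⟨fun s => hF.lift ⟨s.pt, s.π ≫ Functor.whiskerLeft K i⟩ ≫ p.app _, fun s j => ?_,
      fun s m hm => ?_⟩⟩
    · have := hF.fac ⟨s.pt, s.π ≫ Functor.whiskerLeft K i⟩ j
      dsimp at this ⊢
      rw [Category.assoc, ← p.naturality, reassoc_of% this, h', Category.comp_id]
    · have : hF.lift ⟨s.pt, s.π ≫ Functor.whiskerLeft K i⟩ = m ≫ i.app _ := by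
        refine hF.hom_ext fun j => ?_
        rw [hF.fac]
        dsimp at hm ⊢
        rw [← hm, Category.assoc, Category.assoc, i.naturality]
      rw [this, Category.assoc, h']; exact (Category.comp_id m).symm

end Retracts

/-! ## Grothendieck topoi as reflective subcategories of presheaves -/

section GrothendieckTopos

variable {E : Type (u + 1)} [Category.{u} E]

theorem IsGrothendieckTopos.exists_reflection (h : IsGrothendieckTopos E) :
    ∃ (C : Type u) (_ : SmallCategory C) (a : (Cᵒᵖ ⥤ Type u) ⥤ E) (i : E ⥤ Cᵒᵖ ⥤ Type u),
      Nonempty (a ⊣ i) ∧ i.Full ∧ i.Faithful ∧ PreservesFiniteLimits a := by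
  obtain ⟨C, _, J, ⟨e⟩⟩ := h
  exact ⟨C, inferInstance, presheafToSheaf J (Type u) ⋙ e.inverse,
    e.functor ⋙ sheafToPresheaf J (Type u),
    ⟨(sheafificationAdjunction J (Type u)).comp e.symm.toAdjunction⟩, inferInstance, inferInstance,
    comp_preservesFiniteLimits _ _⟩

theorem IsGrothendieckTopos.hasColimits (h : IsGrothendieckTopos E) :
    HasColimitsOfSize.{u, u} E := by
  obtain ⟨C, _, a, i, ⟨adj⟩, _, _, _⟩ := h.exists_reflection
  let _ : Reflective i := ⟨a, adj⟩
  exact hasColimits_of_reflective i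

theorem IsGrothendieckTopos.hasLimits (h : IsGrothendieckTopos E) :
    HasLimitsOfSize.{u, u} E := by
  obtain ⟨C, _, a, i, ⟨adj⟩, _, _, _⟩ := h.exists_reflection
  let _ : Reflective i := ⟨a, adj⟩
  exact hasLimits_of_reflective i

/-- A cocontinuous functor from a topos to a locally small category is a left adjoint. -/
theorem IsGrothendieckTopos.isLeftAdjoint (h : IsGrothendieckTopos E) {F : Type (u + 1)}
    [Category.{u} F] [HasColimitsOfSize.{u, u} F] (L : E ⥤ F) [PreservesColimitsOfSize.{u, u} L] :
    L.IsLeftAdjoint := by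
  obtain ⟨C, _, a, i, ⟨adj⟩, _, _, _⟩ := h.exists_reflection
  let _ : Reflective i := ⟨a, adj⟩
  have := adj.leftAdjoint_preservesColimits
  -- On presheaves, cocontinuity suffices: `a ⋙ L` is a Yoneda extension, with right adjoint the
  -- nerve `N`. What remains is to see that `N` takes values in the reflective subcategory.
  obtain ⟨e, -⟩ := cocontinuous_exists_iso (L := a ⋙ L) (G := yonedaExt (yoneda ⋙ a ⋙ L))
    (yonedaCompYonedaExt _).symm
  let adj' : a ⋙ L ⊣ nerve (yoneda ⋙ a ⋙ L) := (yonedaExtAdjunction _).ofNatIsoLeft e.symm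
  let N := nerve (yoneda ⋙ a ⋙ L)
  -- Maps into `N.obj y` depend only on the reflection of their source, so the identity of `N.obj y`
  -- extends along the unit. An object whose unit is a split monomorphism belongs to the
  -- subcategory.
  have hN : ∀ y : F, IsIso (adj.unit.app (N.obj y)) := fun y => by
    have : IsSplitMono (adj.unit.app (N.obj y)) := by
      refine ⟨⟨⟨adj'.homEquiv _ _ (L.map (adj.counit.app (a.obj (N.obj y))) ≫
        adj'.counit.app y), ?_⟩⟩⟩
      rw [← adj'.homEquiv_naturality_left]
      apply (adj'.homEquiv _ _).symm.injective
      rw [Equiv.symm_apply_apply]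
      refine Eq.trans ?_ (adj'.homEquiv_symm_id y).symm
      dsimp
      rw [← L.map_comp_assoc, adj.left_triangle_components, L.map_id, Category.id_comp]
    have : IsSplitMono ((reflectorAdjunction i).unit.app (N.obj y)) := this
    exact (mem_essImage_of_unit_isSplitMono (i := i)).unit_isIso
  refine ⟨N ⋙ a, ⟨adj'.restrictFullyFaithful (iC := i) (iD := 𝟭 F)
    (Functor.FullyFaithful.ofFullyFaithful i) (Functor.FullyFaithful.id F)
    (Functor.isoWhiskerRight (asIso adj.counit) L) ?_⟩⟩
  exact (NatIso.ofComponents (fun y => asIso (adj.unit.app (N.obj y)))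
    fun f => adj.unit.naturality (N.map f))

end GrothendieckTopos

/-! ## Left exact extensions along the Yoneda embedding -/

section Diaconescu

variable {C : Type u} [SmallCategory C] [HasFiniteLimits C]

/-- The category of elements of a left exact set-valued functor has finite limits, hence is
cofiltered, so the functor is a point of the trivial topology. The presheaf fibre functor of a point
is left exact and cocontinuous, and here it agrees with `L` on representables. -/
theorem lex_of_yoneda_comp_lex_type (L : (Cᵒᵖ ⥤ Type u) ⥤ Type u)
    [PreservesColimitsOfSize.{u, u} L] [PreservesFiniteLimits (yoneda ⋙ L)] :
    PreservesFiniteLimits L := by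
  let Φ : (⊥ : GrothendieckTopology C).Point :=
    { fiber := yoneda ⋙ L
      isCofiltered :=
        have : HasFiniteLimits (yoneda ⋙ L).Elements := ⟨fun J _ _ => inferInstance⟩
        IsCofiltered.of_hasFiniteLimits _
      initiallySmall := initiallySmall_of_essentiallySmall _
      jointly_surjective := fun R hR x => by
        obtain rfl : R = ⊤ := by simpa using hR
        exact ⟨_, 𝟙 _, trivial, x, by simp⟩ }
  obtain ⟨e, -⟩ := cocontinuous_exists_iso (L := Φ.presheafFiber) (G := L)
    (Functor.isoWhiskerRight shrinkYonedaIsoYoneda.symm _ ≪≫ Φ.shrinkYonedaCompPresheafFiberIso)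
  exact preservesFiniteLimits_of_natIso e

theorem lex_of_yoneda_comp_lex_presheaf {D : Type u} [SmallCategory D]
    (L : (Cᵒᵖ ⥤ Type u) ⥤ (Dᵒᵖ ⥤ Type u))
    [PreservesColimitsOfSize.{u, u} L] [PreservesFiniteLimits (yoneda ⋙ L)] :
    PreservesFiniteLimits L := by
  refine ⟨fun J _ _ => preservesLimitsOfShape_of_evaluation _ _ fun d => ?_⟩
  have : PreservesFiniteLimits (yoneda ⋙ L ⋙ (evaluation _ (Type u)).obj d) :=
    comp_preservesFiniteLimits (yoneda ⋙ L) ((evaluation _ (Type u)).obj d)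
  have := lex_of_yoneda_comp_lex_type (L ⋙ (evaluation _ (Type u)).obj d)
  infer_instance

/-- A cocontinuous functor from presheaves on a left exact category to a topos is left exact as soon
as it is so on representables. -/
theorem IsGrothendieckTopos.lex_of_yoneda_comp_lex {E : Type (u + 1)} [Category.{u} E]
    (h : IsGrothendieckTopos E) (L : (Cᵒᵖ ⥤ Type u) ⥤ E)
    [PreservesColimitsOfSize.{u, u} L] [PreservesFiniteLimits (yoneda ⋙ L)] :
    PreservesFiniteLimits L := by
  obtain ⟨D, _, a, i, ⟨adj⟩, _, _, _⟩ := h.exists_reflection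
  have := adj.leftAdjoint_preservesColimits
  have := adj.rightAdjoint_preservesLimits
  -- Passing through presheaves on a site of `E` reduces to the previous case; applying the left
  -- exact reflector `a` then recovers `L`, since the counit is invertible.
  let F := (yoneda ⋙ L) ⋙ i
  have : PreservesFiniteLimits F := comp_preservesFiniteLimits _ _
  have : PreservesFiniteLimits (yoneda ⋙ yonedaExt F) :=
    preservesFiniteLimits_of_natIso (yonedaCompYonedaExt F).symm
  have := lex_of_yoneda_comp_lex_presheaf (yonedaExt F)
  have : PreservesFiniteLimits (yonedaExt F ⋙ a) := comp_preservesFiniteLimits _ _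
  obtain ⟨e, -⟩ := cocontinuous_exists_iso (L := yonedaExt F ⋙ a) (G := L)
    (Functor.isoWhiskerRight (yonedaCompYonedaExt F) a ≪≫
      Functor.isoWhiskerLeft (yoneda ⋙ L) (asIso adj.counit))
  exact preservesFiniteLimits_of_natIso e

end Diaconescu

/-! ## Small dense left exact subcategories -/

section Dense

variable {E : Type (u + 1)} [Category.{u} E]

section NerveHom

variable {C : Type u} [SmallCategory C] {F : C ⥤ E} {x y : E}

/-- The function on generalized elements given by a morphism of restricted Yoneda presheaves. -/
def nerveHomApp (τ : (nerve F).obj x ⟶ (nerve F).obj y) (c : C) (h : F.obj c ⟶ x) : F.obj c ⟶ y :=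
  τ.app (op c) h

theorem nerveHomApp_naturality (τ : (nerve F).obj x ⟶ (nerve F).obj y) {c c' : C} (f : c ⟶ c')
    (h : F.obj c' ⟶ x) : nerveHomApp τ c (F.map f ≫ h) = F.map f ≫ nerveHomApp τ c' h :=
  congr($(τ.naturality f.op) h)

/-- A morphism of restricted Yoneda presheaves from a natural function on generalized elements. -/
def nerveHomMk (t : ∀ c : C, (F.obj c ⟶ x) → (F.obj c ⟶ y))
    (ht : ∀ {c c' : C} (f : c ⟶ c') (h : F.obj c' ⟶ x), t c (F.map f ≫ h) = F.map f ≫ t c' h) :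
    (nerve F).obj x ⟶ (nerve F).obj y where
  app c := ↾(t c.unop)
  naturality c c' f := by ext h; exact ht f.unop h

theorem nerve_hom_ext {τ τ' : (nerve F).obj x ⟶ (nerve F).obj y}
    (h : ∀ (c : C) (k : F.obj c ⟶ x), nerveHomApp τ c k = nerveHomApp τ' c k) : τ = τ' := by
  ext c k
  exact h c.unop k

end NerveHom

/-- The shapes of terminal objects and of pullbacks. -/
def LexShape : Bool → Type := fun b => cond b (Discrete PEmpty.{1}) WalkingCospan

instance : ∀ b, SmallCategory (LexShape b)
  | true => inferInstanceAs (SmallCategory (Discrete PEmpty.{1}))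
  | false => inferInstanceAs (SmallCategory WalkingCospan)

/-- A full subcategory containing a dense one is dense, so the image of `j` can be closed under
finite limits. Terminal objects and pullbacks give all finite limits, and closing a small family
under these two shapes stays essentially small. -/
theorem exists_small_lex_dense [HasFiniteLimits E] {C : Type u} [SmallCategory C] (j : C ⥤ E)
    [(nerve j).Full] [(nerve j).Faithful] :
    ∃ (D : Type u) (_ : SmallCategory D) (_ : HasFiniteLimits D) (K : D ⥤ E),
      PreservesFiniteLimits K ∧ K.Full ∧ K.Faithful ∧ (nerve K).Full ∧ (nerve K).Faithful := by
  let P : ObjectProperty E := (ObjectProperty.ofObj j.obj).limitsClosure LexShape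
  have : P.IsClosedUnderLimitsOfShape (Discrete PEmpty.{1}) :=
    inferInstanceAs (P.IsClosedUnderLimitsOfShape (LexShape true))
  have : P.IsClosedUnderLimitsOfShape WalkingCospan :=
    inferInstanceAs (P.IsClosedUnderLimitsOfShape (LexShape false))
  have : ObjectProperty.EssentiallySmall.{u} P := by
    infer_instance
  have : HasTerminal P.FullSubcategory := inferInstance
  have : HasPullbacks P.FullSubcategory := inferInstance
  have : HasFiniteLimits P.FullSubcategory := hasFiniteLimits_of_hasTerminal_and_pullbacks
  have : PreservesFiniteLimits P.ι :=
    preservesFiniteLimits_of_preservesTerminal_and_pullbacks P.ι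
  have : EssentiallySmall.{u} P.FullSubcategory := inferInstance
  let e := equivSmallModel.{u} P.FullSubcategory
  let K : SmallModel.{u} P.FullSubcategory ⥤ E := e.inverse ⋙ P.ι
  let t : C ⥤ SmallModel.{u} P.FullSubcategory :=
    P.lift j (fun c => ObjectProperty.le_limitsClosure _ _ _ ⟨c⟩) ⋙ e.functor
  let φ : t ⋙ K ≅ j := Functor.isoWhiskerLeft _ (Functor.isoWhiskerRight e.unitIso.symm P.ι)
  have hsep : ∀ {x y : E} (f g : x ⟶ y), (∀ (c : C) (h : j.obj c ⟶ x), h ≫ f = h ≫ g) → f = g :=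
    fun f g hfg => (nerve j).map_injective (by ext c h; exact hfg c.unop h)
  have hsep' : ∀ {x y : E} (f g : x ⟶ y),
      (∀ (d : SmallModel.{u} P.FullSubcategory) (h : K.obj d ⟶ x), h ≫ f = h ≫ g) → f = g :=
    fun f g hfg => hsep f g fun c h => by
      have := hfg (t.obj c) (φ.hom.app c ≫ h)
      rw [Category.assoc, Category.assoc] at this
      exact (cancel_epi _).1 this
  refine ⟨SmallModel.{u} P.FullSubcategory, inferInstance,
    ⟨fun J _ _ => Adjunction.hasLimitsOfShape_of_equivalence e.inverse⟩, K,
    comp_preservesFiniteLimits _ _, inferInstance, inferInstance,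
    ⟨fun {x y} τ => ?_⟩, ⟨fun {x y} f g hfg => ?_⟩⟩
  -- For fullness, restrict `τ` along `t`; density of `j` then provides the only candidate `g`.
  · let σ : (nerve j).obj x ⟶ (nerve j).obj y := nerveHomMk
      (fun c h => φ.inv.app c ≫ nerveHomApp τ (t.obj c) (φ.hom.app c ≫ h)) fun f h => by
        rw [← φ.hom.naturality_assoc, φ.inv.naturality_assoc]
        congr 1
        exact nerveHomApp_naturality τ (t.map f) _
    obtain ⟨g, hg⟩ := (nerve j).map_surjective σ
    have hg' : ∀ (c : C) (h : j.obj c ⟶ x),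
        h ≫ g = φ.inv.app c ≫ nerveHomApp τ (t.obj c) (φ.hom.app c ≫ h) := fun c h =>
      congr($(NatTrans.congr_app hg (op c)) h)
    refine ⟨g, nerve_hom_ext fun d h => hsep _ _ fun c k => ?_⟩
    -- Fullness of `K` turns the test map `k` into a morphism of the small category, where
    -- naturality of `τ` applies.
    obtain ⟨k', hk'⟩ := K.map_surjective (φ.hom.app c ≫ k)
    have hk : k = φ.inv.app c ≫ K.map k' := by rw [hk', Iso.inv_hom_id_app_assoc]
    have h₁ := hg' c (k ≫ h)
    rw [← Category.assoc (φ.hom.app c), ← hk', nerveHomApp_naturality τ k' h] at h₁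
    rw [hk] at h₁ ⊢
    rw [Category.assoc, Category.assoc] at h₁ ⊢
    exact h₁
  · exact hsep' f g fun d h => congr($(NatTrans.congr_app hfg (op d)) h)

end Dense

/-! ## Right Kan extensions, adjunctions and retracts in a bicategory -/

section Bicategories

variable {K : Type u} [Bicategory.{w, v} K]

theorem IsRightKan.hom_ext {A B X : K} {f : A ⟶ B} {x : A ⟶ X} {r : B ⟶ X} {κ : f ≫ r ⟶ x}
    (h : IsRightKan f x r κ) {y : B ⟶ X} {β γ : y ⟶ r} (e : f ◁ β ≫ κ = f ◁ γ ≫ κ) : β = γ :=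
  (isRightKan_iff.1 h y (f ◁ γ ≫ κ)).unique e rfl

/-- Right adjoints preserve right Kan extensions. -/
theorem preservesRightKan_of_adjunction {X Y : K} {l : Y ⟶ X} {h : X ⟶ Y}
    (adj : Bicategory.Adjunction l h) {A B : K} (f : A ⟶ B) : PreservesRightKan h f := by
  intro x r κ hr
  rw [isRightKan_iff] at hr ⊢
  have key : ∀ (y : B ⟶ Y) (β : y ≫ l ⟶ r),
      f ◁ adj.homEquiv₂ β ≫ (α_ f r h).inv ≫ κ ▷ h =
        adj.homEquiv₂ ((α_ f y l).hom ≫ f ◁ β ≫ κ) := by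
    intro y β
    simp only [Bicategory.Adjunction.homEquiv₂_apply]
    bicategory
  intro y α
  obtain ⟨β, hβ, hu⟩ := hr (y ≫ l) ((α_ f y l).inv ≫ adj.homEquiv₂.symm α)
  refine ⟨adj.homEquiv₂ β, ?_, fun γ hγ => ?_⟩
  · simp only [key, hβ, Iso.hom_inv_id_assoc, Equiv.apply_symm_apply]
  · obtain ⟨γ, rfl⟩ := adj.homEquiv₂.surjective γ
    simp only [key] at hγ
    rw [hu γ (by simp [← hγ])]

/-- If the right Kan extension of the identity along `h` is preserved by `h` then it is a left
adjoint of `h`. -/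
theorem nonempty_adjunction_of_isRightKan {X Y : K} {h : X ⟶ Y} {r : Y ⟶ X} {κ : h ≫ r ⟶ 𝟙 X}
    (hr : IsRightKan h (𝟙 X) r κ) (hp : IsRightKan h (𝟙 X ≫ h) (r ≫ h) ((α_ h r h).inv ≫ κ ▷ h)) :
    Nonempty (Bicategory.Adjunction r h) := by
  -- The unit factors the canonical cell through the preserved extension, which is one triangle
  -- identity; the other comes from uniqueness of factorisations through `κ`.
  obtain ⟨η, hη, -⟩ := isRightKan_iff.1 hp (𝟙 Y) ((ρ_ h).hom ≫ (λ_ h).inv)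
  have hη' : Bicategory.rightZigzag η κ = (ρ_ h).hom ≫ (λ_ h).inv := by
    rw [← hη, Bicategory.rightZigzag]; bicategory
  refine ⟨⟨η, κ, ?_, hη'⟩⟩
  have : (λ_ r).inv ≫ Bicategory.leftZigzag η κ ≫ (ρ_ r).hom = 𝟙 r := by
    refine hr.hom_ext ?_
    calc _ = 𝟙 _ ⊗≫ h ◁ η ▷ r ⊗≫ ((h ≫ r) ◁ κ ≫ κ ▷ 𝟙 X) ⊗≫ 𝟙 _ := by
            rw [Bicategory.leftZigzag]; bicategory
      _ = 𝟙 _ ⊗≫ Bicategory.rightZigzag η κ ▷ r ⊗≫ κ ⊗≫ 𝟙 _ := by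
            rw [Bicategory.whisker_exchange, Bicategory.rightZigzag]; bicategory
      _ = _ := by
            rw [hη']; bicategory
  rw [← cancel_epi (λ_ r).inv, ← cancel_mono (ρ_ r).hom, Category.assoc, this]
  simp

/-- A weak right Kan extension with natural choices of factorisations can be corrected to a right
Kan extension by splitting an idempotent. -/
theorem exists_isRightKan_of_natural_section {A B X : K} [IsIdempotentComplete (B ⟶ X)]
    {f : A ⟶ B} {x : A ⟶ X} {g : B ⟶ X} (κ : f ≫ g ⟶ x)
    (S : ∀ y : B ⟶ X, (f ≫ y ⟶ x) → (y ⟶ g)) (hS : ∀ y α, f ◁ S y α ≫ κ = α)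
    (hS' : ∀ (y y' : B ⟶ X) (b : y' ⟶ y) (α), S y' (f ◁ b ≫ α) = b ≫ S y α) :
    ∃ (r : B ⟶ X) (i : r ⟶ g), IsRightKan f x r (f ◁ i ≫ κ) ∧
      (IsIso κ → IsIso (f ◁ i ≫ κ)) := by
  let e := S g κ
  have he : f ◁ e ≫ κ = κ := hS g κ
  have hee : e ≫ e = e := by
    -- Naturality of `S` along `e` itself gives idempotency, as `e` fixes `κ` after whiskering.
    change e ≫ S g κ = _
    rw [← hS', he]
  obtain ⟨r, i, p, hip, hpi⟩ := IsIdempotentComplete.idempotents_split g e hee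
  have hp : f ◁ p ≫ f ◁ i ≫ κ = κ := by
    rw [← Bicategory.whiskerLeft_comp_assoc, hpi, he]
  refine ⟨r, i, isRightKan_iff.2 fun y α => ⟨S y α ≫ p, ?_, fun γ hγ => ?_⟩, fun h => ?_⟩
  · beta_reduce
    rw [Bicategory.whiskerLeft_comp, Category.assoc, hp, hS]
  · have : γ ≫ i ≫ S g κ = S y α := by
      rw [← Category.assoc, ← hS', Bicategory.whiskerLeft_comp, Category.assoc, hγ]
    rw [← this]
    change _ = (γ ≫ i ≫ e) ≫ p
    rw [← hpi]
    simp [hip]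
  -- Cancelling an invertible `κ` shows that `e` becomes an identity after whiskering with `f`, so
  -- `f ◁ i` is invertible.
  · have hfi : f ◁ p ≫ f ◁ i = 𝟙 _ := by
      rw [← cancel_mono κ, Category.assoc, hp, Category.id_comp]
    have : IsIso (f ◁ i) :=
      ⟨f ◁ p, by rw [← Bicategory.whiskerLeft_comp, hip, Bicategory.whiskerLeft_id], hfi⟩
    infer_instance

/-- Extend `x ≫ s` in `X` and return along `p`. Factorisations through `R ≫ p` then exist and are
natural, but they need not be unique; splitting the resulting idempotent repairs this and keeps
invertibility of the counit. -/
theorem IsRetract.exists_isRightKan {X Y : K} (h : IsRetract Y X) {A B : K} (f : A ⟶ B)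
    [IsIdempotentComplete (B ⟶ Y)] (x : A ⟶ Y) :
    ∃ (P : A ⟶ X), ∀ (R : B ⟶ X) (κ : f ≫ R ⟶ P), IsRightKan f P R κ →
      ∃ (r : B ⟶ Y) (θ : f ≫ r ⟶ x), IsRightKan f x r θ ∧ (IsIso κ → IsIso θ) := by
  obtain ⟨s, p, ⟨e⟩⟩ := h
  refine ⟨x ≫ s, fun R κ hR => ?_⟩
  let θ : f ≫ R ≫ p ⟶ x := (α_ f R p).inv ≫ κ ▷ p ≫ (α_ x s p).hom ≫ x ◁ e.hom ≫ (ρ_ x).hom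
  choose β hβ using fun (y : B ⟶ Y) (α : f ≫ y ⟶ x) =>
    (isRightKan_iff.1 hR (y ≫ s) ((α_ f y s).inv ≫ α ▷ s)).exists
  obtain ⟨r, i, hr, hi⟩ := exists_isRightKan_of_natural_section θ
    (fun y α => (ρ_ y).inv ≫ y ◁ e.inv ≫ (α_ y s p).inv ≫ β y α ▷ p)
    (fun y α => by
      calc _ = 𝟙 _ ⊗≫ f ◁ y ◁ e.inv ⊗≫ (f ◁ β y α ≫ κ) ▷ p ⊗≫ x ◁ e.hom ⊗≫ 𝟙 _ := by
              dsimp only [θ]; bicategory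
        _ = 𝟙 _ ⊗≫ ((f ≫ y) ◁ e.inv ≫ α ▷ (s ≫ p)) ⊗≫ x ◁ e.hom ⊗≫ 𝟙 _ := by
              rw [hβ]; bicategory
        _ = 𝟙 _ ⊗≫ α ⊗≫ x ◁ (e.inv ≫ e.hom) ⊗≫ 𝟙 _ := by
              rw [Bicategory.whisker_exchange]; bicategory
        _ = α := by
              rw [e.inv_hom_id]; bicategory)
    (fun y y' b α => by
      have : β y' (f ◁ b ≫ α) = b ▷ s ≫ β y α := by
        refine hR.hom_ext ?_
        rw [hβ, Bicategory.whiskerLeft_comp, Category.assoc, hβ]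
        bicategory
      rw [this]
      calc _ = 𝟙 _ ⊗≫ (y' ◁ e.inv ≫ b ▷ (s ≫ p)) ⊗≫ β y α ▷ p := by bicategory
        _ = _ := by rw [Bicategory.whisker_exchange]; bicategory)
  refine ⟨r, _, hr, fun _ => hi ?_⟩
  infer_instance

theorem IsRetract.isRightKanInjective {X Y : K} (h : IsRetract Y X) {A B : K} (f : A ⟶ B)
    [IsIdempotentComplete (B ⟶ Y)] (hX : IsRightKanInjective X f) :
    IsRightKanInjective Y f := by
  intro x
  obtain ⟨P, hP⟩ := h.exists_isRightKan f x
  obtain ⟨R, κ, hR, hκ⟩ := hX P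
  obtain ⟨r, θ, hr, hθ⟩ := hP R κ hR
  exact ⟨r, θ, hr, hθ hκ⟩

theorem IsCoadjointRetract.isRetract {X Y : K} (h : IsCoadjointRetract Y X) : IsRetract Y X := by
  obtain ⟨s, r, -, e⟩ := h
  exact ⟨s, r, e⟩

end Bicategories

/-! ### Zigzags as explicit composites -/

section Zigzag

variable {K : Type u} [Bicategory.{w, v} K] {a b : K} {f : a ⟶ b} {g : b ⟶ a}

/-- Writing out the coherence cells lets the components in `Topos` be computed by unfolding. -/
theorem leftZigzag_eq (η : 𝟙 a ⟶ f ≫ g) (θ : g ≫ f ⟶ 𝟙 b) :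
    Bicategory.leftZigzag η θ = η ▷ f ≫ (α_ f g f).hom ≫ f ◁ θ := by
  rw [Bicategory.leftZigzag]; bicategory

theorem rightZigzag_eq (η : 𝟙 a ⟶ f ≫ g) (θ : g ≫ f ⟶ 𝟙 b) :
    Bicategory.rightZigzag η θ = g ◁ η ≫ (α_ g f g).inv ≫ θ ▷ g := by
  rw [Bicategory.rightZigzag]; bicategory

end Zigzag

/-! ## Geometric morphisms and their inverse images -/

namespace Topos

variable {A B E F X Y : Topos.{u}}

instance (E : Topos.{u}) : HasColimitsOfSize.{u, u} E.carrier := E.isTopos.hasColimits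

instance (E : Topos.{u}) : HasLimitsOfSize.{u, u} E.carrier := E.isTopos.hasLimits

instance (f : E ⟶ F) : PreservesFiniteLimits (invIm f) := GeomMorphism.lex f

instance (f : E ⟶ F) : PreservesFiniteLimits (dirIm f) := dirIm_lex f

instance (f : E ⟶ F) : PreservesColimitsOfSize.{u, u} (invIm f) :=
  (GeomMorphism.adj f).leftAdjoint_preservesColimits

/-- The geometric morphism with a given left exact left adjoint as inverse image. -/
def geomOfAdj {L : F.carrier ⥤ E.carrier} {R : E.carrier ⥤ F.carrier} (adj : L ⊣ R)
    [PreservesFiniteLimits L] : E ⟶ F :=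
  GeomMorphism.mk (E := E) (F := F) R L adj inferInstance

/-- The geometric morphism with a given left exact cocontinuous functor as inverse image. -/
def geomOfInv (L : F.carrier ⥤ E.carrier) [PreservesFiniteLimits L]
    [PreservesColimitsOfSize.{u, u} L] : E ⟶ F :=
  have := F.isTopos.isLeftAdjoint L
  geomOfAdj (Adjunction.ofIsLeftAdjoint L)

/-- An isomorphism of inverse images is an invertible 2-cell. -/
def isoOfInv {f g : E ⟶ F} (e : invIm f ≅ invIm g) : f ≅ g where
  hom := GeomTrans.ofInv e.hom
  inv := GeomTrans.ofInv e.inv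
  hom_inv_id := GeomTrans.ext_inv e.hom_inv_id
  inv_hom_id := GeomTrans.ext_inv e.inv_hom_id

/-- The isomorphism of inverse images underlying an invertible 2-cell. -/
def invOfIso {f g : E ⟶ F} (e : f ≅ g) : invIm f ≅ invIm g where
  hom := GeomMorphism.inv₂ e.hom
  inv := GeomMorphism.inv₂ e.inv
  hom_inv_id := congrArg GeomTrans.inv e.hom_inv_id
  inv_hom_id := congrArg GeomTrans.inv e.inv_hom_id

instance (f g : E ⟶ F) (η : f ⟶ g) [IsIso η] : IsIso (GeomMorphism.inv₂ η) :=
  (invOfIso (asIso η)).isIso_hom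

theorem isIso_of_inv₂ {f g : E ⟶ F} (η : f ⟶ g) (h : IsIso (GeomMorphism.inv₂ η)) : IsIso η := by
  convert (isoOfInv (asIso (GeomMorphism.inv₂ η))).isIso_hom
  exact GeomMorphism.hom₂_ext rfl

/-- An adjunction between inverse images is an adjunction between geometric morphisms. -/
def adjunctionOfInv {s : E ⟶ F} {r : F ⟶ E} (adj : invIm r ⊣ invIm s) :
    Bicategory.Adjunction s r where
  unit := GeomTrans.ofInv (f := 𝟙 E) (g := s ≫ r) adj.unit
  counit := GeomTrans.ofInv (f := r ≫ s) (g := 𝟙 F) adj.counit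
  left_triangle := by
    rw [leftZigzag_eq]
    refine GeomMorphism.hom₂_ext (NatTrans.ext (funext fun Z => ?_))
    change adj.unit.app ((invIm s).obj Z) ≫ 𝟙 _ ≫ (invIm s).map (adj.counit.app Z) = 𝟙 _ ≫ 𝟙 _
    simp
  right_triangle := by
    rw [rightZigzag_eq]
    refine GeomMorphism.hom₂_ext (NatTrans.ext (funext fun Z => ?_))
    change (invIm r).map (adj.unit.app Z) ≫ 𝟙 _ ≫ adj.counit.app ((invIm r).obj Z) = 𝟙 _ ≫ 𝟙 _
    simp

/-- The adjunction between inverse images underlying an adjunction of geometric morphisms. -/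
def invOfAdjunction {s : E ⟶ F} {r : F ⟶ E} (adj : Bicategory.Adjunction s r) :
    invIm r ⊣ invIm s :=
  Adjunction.mkOfUnitCounit
    { unit := GeomMorphism.inv₂ adj.unit
      counit := GeomMorphism.inv₂ adj.counit
      left_triangle := by
        ext Z
        have h : (GeomMorphism.inv₂ (r ◁ adj.unit ≫ (α_ r s r).inv ≫ adj.counit ▷ r)).app Z = _ :=
          congrArg (fun t => (GeomMorphism.inv₂ t).app Z)
            ((rightZigzag_eq _ _).symm.trans adj.right_triangle)
        change (invIm r).map ((GeomMorphism.inv₂ adj.unit).app Z) ≫ 𝟙 _ ≫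
          (GeomMorphism.inv₂ adj.counit).app ((invIm r).obj Z) = 𝟙 _ ≫ 𝟙 _ at h
        exact h.trans (Category.id_comp _)
      right_triangle := by
        ext Z
        have h : (GeomMorphism.inv₂ (adj.unit ▷ s ≫ (α_ s r s).hom ≫ s ◁ adj.counit)).app Z = _ :=
          congrArg (fun t => (GeomMorphism.inv₂ t).app Z)
            ((leftZigzag_eq _ _).symm.trans adj.left_triangle)
        change (GeomMorphism.inv₂ adj.unit).app ((invIm s).obj Z) ≫ 𝟙 _ ≫
          (invIm s).map ((GeomMorphism.inv₂ adj.counit).app Z) = 𝟙 _ ≫ 𝟙 _ at h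
        exact h.trans (Category.id_comp _) }

/-- The idempotent splits among functors because `E` has equalizers. The resulting retract of `f^*`
is left exact and cocontinuous, hence an inverse image. -/
instance (E F : Topos.{u}) : IsIdempotentComplete (E ⟶ F) where
  idempotents_split f e he := by
    have : IsIdempotentComplete E.carrier :=
      (Idempotents.isIdempotentComplete_iff_hasEqualizer_of_id_and_idempotent _).2
        fun _ _ _ => inferInstance
    obtain ⟨L, i, p, hip, hpi⟩ := IsIdempotentComplete.idempotents_split (invIm f)
      (GeomMorphism.inv₂ e) (congrArg GeomTrans.inv he)
    have : PreservesFiniteLimits L :=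
      ⟨fun J _ _ => ⟨preservesLimit_of_retract i p hip⟩⟩
    have : PreservesColimitsOfSize.{u, u} L :=
      ⟨⟨preservesColimit_of_retract i p hip⟩⟩
    exact ⟨geomOfInv L, GeomTrans.ofInv (f := geomOfInv L) i, GeomTrans.ofInv (g := geomOfInv L) p,
      GeomMorphism.hom₂_ext hip, GeomMorphism.hom₂_ext hpi⟩

/-! ## Ethereal geometric morphisms -/

/-- If the left exact functor `h_*` is cocontinuous, it is the inverse image of some `l`, and `h^* ⊣
h_*` reads as `l ⊣ h`. Conversely, `l ⊣ h` makes `l^*` a right adjoint of `h^*`, so `h_* ≅ l^*` is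
cocontinuous. -/
theorem isEthereal_iff_exists_adjunction (h : X ⟶ Y) :
    IsEthereal h ↔ ∃ l : Y ⟶ X, Nonempty (Bicategory.Adjunction l h) := by
  constructor
  · intro hh
    have : PreservesColimitsOfSize.{u, u} (dirIm h) := hh
    exact ⟨geomOfInv (dirIm h), ⟨adjunctionOfInv (GeomMorphism.adj h)⟩⟩
  · rintro ⟨l, ⟨adj⟩⟩
    exact preservesColimits_of_natIso
      ((invOfAdjunction adj).rightAdjointUniq (GeomMorphism.adj h))

theorem wrInj_hom_iff_isEthereal (hX : (WRInj allGeom.{u}).obj X) (h : X ⟶ Y) :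
    (WRInj allGeom.{u}).hom h ↔ IsEthereal h := by
  rw [isEthereal_iff_exists_adjunction]
  constructor
  · intro hh
    obtain ⟨r, κ, hr⟩ := hX h trivial (𝟙 X)
    exact ⟨r, nonempty_adjunction_of_isRightKan hr (hh h trivial _ _ _ hr)⟩
  · rintro ⟨l, ⟨adj⟩⟩ A B f _
    exact preservesRightKan_of_adjunction adj f

/-! ## Right Kan extensions of geometric morphisms -/

/-- Transposition of natural transformations along a geometric morphism. -/
def transpose (f : A ⟶ B) {L : X.carrier ⥤ B.carrier} {G : X.carrier ⥤ A.carrier} :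
    (L ⋙ invIm f ⟶ G) ≃ (L ⟶ G ⋙ dirIm f) :=
  ((GeomMorphism.adj f).whiskerRight X.carrier).homEquiv L G

theorem transpose_naturality_left (f : A ⟶ B) {L L' : X.carrier ⥤ B.carrier}
    {G : X.carrier ⥤ A.carrier} (β : L' ⟶ L) (α : L ⋙ invIm f ⟶ G) :
    transpose f (Functor.whiskerRight β (invIm f) ≫ α) = β ≫ transpose f α :=
  ((GeomMorphism.adj f).whiskerRight X.carrier).homEquiv_naturality_left β α

theorem transpose_symm_app (f : A ⟶ B) {L : X.carrier ⥤ B.carrier} {G : X.carrier ⥤ A.carrier}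
    (γ : L ⟶ G ⋙ dirIm f) (Z : X.carrier) :
    ((transpose f).symm γ).app Z =
      (invIm f).map (γ.app Z) ≫ (GeomMorphism.adj f).counit.app (G.obj Z) := by
  rw [transpose, Adjunction.homEquiv_counit]
  simp [Adjunction.whiskerRight]

/-- Transposing along `f^* ⊣ f_*` turns the Kan property into terminality among inverse image
functors over `f_* x^*`. -/
theorem isRightKan_iff_inv {f : A ⟶ B} {x : A ⟶ X} {r : B ⟶ X} {κ : f ≫ r ⟶ x} :
    IsRightKan f x r κ ↔ ∀ (y : B ⟶ X) (δ : invIm y ⟶ invIm x ⋙ dirIm f),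
      ∃! β : invIm y ⟶ invIm r, β ≫ transpose f (GeomMorphism.inv₂ κ) = δ := by
  have key : ∀ (y : B ⟶ X) (β : y ⟶ r) (α : f ≫ y ⟶ x), f ◁ β ≫ κ = α ↔
      GeomMorphism.inv₂ β ≫ transpose f (GeomMorphism.inv₂ κ) =
        transpose f (GeomMorphism.inv₂ α) := fun y β α => by
    rw [← transpose_naturality_left, (transpose f).injective.eq_iff]
    exact ⟨fun h => congrArg GeomTrans.inv h, fun h => GeomMorphism.hom₂_ext h⟩
  rw [isRightKan_iff]
  constructor
  · intro h y δ
    obtain ⟨β, hβ, hu⟩ := h y (GeomTrans.ofInv (f := f ≫ y) ((transpose f).symm δ))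
    refine ⟨GeomMorphism.inv₂ β, ?_, fun γ hγ => ?_⟩
    · exact ((key _ _ _).1 hβ).trans ((transpose f).apply_symm_apply δ)
    · exact congrArg GeomTrans.inv (hu (GeomTrans.ofInv γ)
        ((key _ _ _).2 (hγ.trans ((transpose f).apply_symm_apply δ).symm)))
  · intro h y α
    obtain ⟨β, hβ, hu⟩ := h y (transpose f (GeomMorphism.inv₂ α))
    exact ⟨GeomTrans.ofInv β, (key _ _ _).2 hβ, fun γ hγ =>
      GeomMorphism.hom₂_ext (hu _ ((key _ _ _).1 hγ))⟩

/-- The 2-cell `f ≫ r ⟶ x` with a given transpose `r^* ⟶ f_* x^*`. -/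
def cellOfTranspose (f : A ⟶ B) {x : A ⟶ X} {r : B ⟶ X}
    (γ : invIm r ⟶ invIm x ⋙ dirIm f) : f ≫ r ⟶ x :=
  GeomTrans.ofInv (f := f ≫ r) ((transpose f).symm γ)

theorem isRightKan_cellOfTranspose_iff {f : A ⟶ B} {x : A ⟶ X} {r : B ⟶ X}
    {γ : invIm r ⟶ invIm x ⋙ dirIm f} :
    IsRightKan f x r (cellOfTranspose f γ) ↔ ∀ (y : B ⟶ X) (δ : invIm y ⟶ invIm x ⋙ dirIm f),
      ∃! β : invIm y ⟶ invIm r, β ≫ γ = δ := by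
  rw [isRightKan_iff_inv]
  have : transpose f (GeomMorphism.inv₂ (cellOfTranspose f γ)) = γ :=
    (transpose f).apply_symm_apply γ
  rw [this]

/-! ## Pointwise right Kan extensions -/

/-- Since 2-cells in `ToposLexCo` are reversed, pointwise means that `r_*` is the left Kan extension
of `x_*` along `f_*` among left exact functors. -/
theorem isPointwise_iff {f : A ⟶ B} {x : A ⟶ X} {r : B ⟶ X} {κ : f ≫ r ⟶ x} :
    IsPointwise directImage.{u} f x r κ ↔
      ∀ (G : B.carrier ⥤ X.carrier) (_ : PreservesFiniteLimits G) (α : dirIm x ⟶ dirIm f ⋙ G),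
        ∃! β : dirIm r ⟶ G, (GeomMorphism.dir₂ κ : dirIm x ⟶ dirIm f ⋙ dirIm r) ≫
          Functor.whiskerLeft (dirIm f) β = α := by
  rw [IsPointwise, isRightKan_iff]
  have key : ∀ (y : directImage.obj B ⟶ directImage.obj X) (β : y ⟶ directImage.map r),
      ToposLexCo.nt (directImage.map f ◁ β ≫ (directImage.mapComp f r).inv ≫ directImage.map₂ κ) =
        (GeomMorphism.dir₂ κ : dirIm x ⟶ dirIm f ⋙ dirIm r) ≫
          Functor.whiskerLeft (dirIm f) (ToposLexCo.nt β) := fun y β => by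
    ext Z
    change ((GeomMorphism.dir₂ κ).app Z ≫ 𝟙 _) ≫ _ = _
    rw [Category.comp_id]
    rfl
  constructor
  · intro h G hG α
    let y : directImage.obj B ⟶ directImage.obj X :=
      ToposLexCo.Hom.mk (E := ⟨B⟩) (F := ⟨X⟩) G hG
    obtain ⟨β, hβ, hu⟩ := h y (ToposLexCo.Hom₂.mk (f := directImage.map f ≫ y) α)
    refine ⟨ToposLexCo.nt β, ?_, fun γ hγ => ?_⟩
    · exact (key y β).symm.trans (congrArg ToposLexCo.Hom₂.nat hβ)
    · exact congrArg ToposLexCo.Hom₂.nat (hu (ToposLexCo.Hom₂.mk (f := y) γ)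
        (ToposLexCo.Hom₂.ext ((key y (ToposLexCo.Hom₂.mk (f := y) γ)).trans hγ)))
  · intro h y α
    obtain ⟨β, hβ, hu⟩ := h (ToposLexCo.fn y) (ToposLexCo.Hom.lex y) (ToposLexCo.nt α)
    refine ⟨ToposLexCo.Hom₂.mk (f := y) β, ?_, fun γ hγ => ?_⟩
    · exact ToposLexCo.Hom₂.ext ((key y (ToposLexCo.Hom₂.mk (f := y) β)).trans hβ)
    · exact ToposLexCo.Hom₂.ext (hu _ ((key y γ).symm.trans (congrArg ToposLexCo.Hom₂.nat hγ)))

end Topos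

/-! ## Invariance of pointwise right Kan extensions -/

section Pointwise

variable {K : Type u} [Bicategory.{w, v} K] {M : Type u₂} [Bicategory.{w₂, v₂} M]

theorem IsRightKan.exists_iso {A B X : K} {f : A ⟶ B} {x : A ⟶ X} {r r' : B ⟶ X}
    {κ : f ≫ r ⟶ x} {κ' : f ≫ r' ⟶ x} (h : IsRightKan f x r κ) (h' : IsRightKan f x r' κ') :
    ∃ i : r' ≅ r, f ◁ i.hom ≫ κ = κ' := by
  obtain ⟨a, ha, -⟩ := isRightKan_iff.1 h r' κ'
  obtain ⟨b, hb, -⟩ := isRightKan_iff.1 h' r κ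
  exact ⟨⟨a, b, h'.hom_ext (by simp [ha, hb]), h.hom_ext (by simp [ha, hb])⟩, ha⟩

variable {P : Pseudofunctor K M} {A B X Y : K} {f : A ⟶ B} {x x' : A ⟶ X} {r r' : B ⟶ X}
  {κ : f ≫ r ⟶ x}

theorem IsPointwise.of_iso (h : IsPointwise P f x r κ) (i : r' ≅ r) (e : x ≅ x') :
    IsPointwise P f x' r' (f ◁ i.hom ≫ κ ≫ e.hom) := by
  have := IsRightKan.of_iso h (P.map₂Iso i) (P.map₂Iso e)
  rw [IsPointwise]
  convert! this using 1
  simp [Pseudofunctor.map₂_whisker_left]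

theorem IsPointwise.of_isRightKan {κ' : f ≫ r' ⟶ x} (h : IsPointwise P f x r κ)
    (hκ : IsRightKan f x r κ) (hκ' : IsRightKan f x r' κ') : IsPointwise P f x r' κ' := by
  obtain ⟨i, rfl⟩ := hκ.exists_iso hκ'
  simpa using h.of_iso i (Iso.refl x)

/-- The pseudofunctor `P` preserves adjunctions, so `P.map g` is a right adjoint and preserves the
extension in `M`; the rest is coherence. -/
theorem IsPointwise.of_adjunction (h : IsPointwise P f x r κ) {l : Y ⟶ X} {g : X ⟶ Y}
    (adj : Bicategory.Adjunction l g) :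
    IsPointwise P f (x ≫ g) (r ≫ g) ((α_ f r g).inv ≫ κ ▷ g) := by
  have := (preservesRightKan_of_adjunction (P.mapAdjunction adj) (P.map f) _ _ _ h).of_iso
    (P.mapComp r g) (P.mapComp x g).symm
  rw [IsPointwise]
  convert! this using 1
  have assoc : P.map₂ (α_ f r g).inv = (P.mapComp f (r ≫ g)).hom ≫ P.map f ◁ (P.mapComp r g).hom ≫
      (α_ (P.map f) (P.map r) (P.map g)).inv ≫ (P.mapComp f r).inv ▷ P.map g ≫
        (P.mapComp (f ≫ r) g).inv := by
    rw [← cancel_mono (P.map₂ (α_ f r g).hom), ← P.map₂_comp, Iso.inv_hom_id, P.map₂_id,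
      P.map₂_associator]
    simp
  simp [Pseudofunctor.map₂_whisker_right, assoc]

/-- Extend `x ≫ s` and compose with the right adjoint `p`, which preserves both the extension and
its pointwise character. Uniqueness of Kan extensions transfers the latter to any other choice. -/
theorem IsCoadjointRetract.wrInjPw_obj (h : IsCoadjointRetract Y X) {H : MorphismProperty K}
    (hX : (WRInjPw P H).obj X) : (WRInjPw P H).obj Y := by
  obtain ⟨s, p, ⟨adj⟩, ⟨e⟩⟩ := h
  have key : ∀ ⦃A B : K⦄ (f : A ⟶ B), H f → ∀ x : A ⟶ Y, ∃ (r : B ⟶ Y) (κ : f ≫ r ⟶ x),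
      IsRightKan f x r κ ∧ IsPointwise P f x r κ := fun A B f hf x => by
    obtain ⟨R, κ, hR⟩ := hX.1 f hf (x ≫ s)
    have hR' := hX.2 f hf _ _ _ hR
    exact ⟨R ≫ p, _, (preservesRightKan_of_adjunction adj f _ _ _ hR).of_iso (Iso.refl _)
      (α_ x s p ≪≫ Bicategory.whiskerLeftIso x e ≪≫ ρ_ x),
      (hR'.of_adjunction adj).of_iso (Iso.refl _) _⟩
  refine ⟨fun A B f hf x => ?_, fun A B f hf x r κ hr => ?_⟩
  · obtain ⟨r, κ, hr, -⟩ := key f hf x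
    exact ⟨r, κ, hr⟩
  · obtain ⟨r', κ', hr', hp⟩ := key f hf x
    exact hp.of_isRightKan hr' hr

end Pointwise

/-! ## Kan extensions into presheaf categories -/

section Presheaves

variable {C : Type u} [SmallCategory C]

theorem exists_presheaf_hom {P Q : Cᵒᵖ ⥤ Type u}
    (t : ∀ c : C, (yoneda.obj c ⟶ P) → (yoneda.obj c ⟶ Q))
    (ht : ∀ {c c' : C} (k : c ⟶ c') (z : yoneda.obj c' ⟶ P),
      t c (yoneda.map k ≫ z) = yoneda.map k ≫ t c' z) :
    ∃ β : P ⟶ Q, ∀ (c : C) (z : yoneda.obj c ⟶ P), z ≫ β = t c z := by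
  refine ⟨{ app := fun c => ↾fun p => yonedaEquiv (t c.unop (yonedaEquiv.symm p))
            naturality := fun c c' k => ?_ }, fun c z => ?_⟩
  · ext p
    have := congrArg yonedaEquiv (ht k.unop (yonedaEquiv.symm p))
    rw [← yonedaEquiv_symm_map, ← yonedaEquiv_naturality'] at this
    exact this
  · apply yonedaEquiv.injective
    rw [yonedaEquiv_comp]
    change yonedaEquiv (t c (yonedaEquiv.symm (yonedaEquiv z))) = _
    rw [Equiv.symm_apply_apply]

theorem presheaf_hom_ext {P Q : Cᵒᵖ ⥤ Type u} {β β' : P ⟶ Q}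
    (h : ∀ (c : C) (z : yoneda.obj c ⟶ P), z ≫ β = z ≫ β') : β = β' := by
  ext c p
  have := congrArg yonedaEquiv (h c.unop (yonedaEquiv.symm p))
  rw [yonedaEquiv_comp, yonedaEquiv_comp, Equiv.apply_symm_apply] at this
  exact this

section

variable {E : Type*} [Category* E]

/-- A transformation out of the cocontinuous `L'` is the same as one on representables, where `γ`
can be inverted. -/
theorem exists_unique_cocontinuous_lift {L L' G : (Cᵒᵖ ⥤ Type u) ⥤ E}
    [PreservesColimitsOfSize.{u, u} L'] (γ : L ⟶ G) (hγ : ∀ c, IsIso (γ.app (yoneda.obj c)))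
    (δ : L' ⟶ G) : ∃! β : L' ⟶ L, β ≫ γ = δ := by
  have : ∀ c, IsIso ((Functor.whiskerLeft yoneda γ).app c) := hγ
  have : IsIso (Functor.whiskerLeft yoneda γ) := NatIso.isIso_of_isIso_app _
  obtain ⟨β, hβ⟩ := cocontinuous_exists_hom (L := L') (G := L)
    (Functor.whiskerLeft yoneda δ ≫ inv (Functor.whiskerLeft yoneda γ))
  refine ⟨β, cocontinuous_hom_ext fun c => ?_, fun β' h => cocontinuous_hom_ext fun c => ?_⟩
  · simp [hβ]
  · simp [hβ, ← h]

theorem isIso_of_isIso_yoneda {L G : (Cᵒᵖ ⥤ Type u) ⥤ E} [PreservesColimitsOfSize.{u, u} L]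
    [PreservesColimitsOfSize.{u, u} G] (α : L ⟶ G) (h : ∀ c, IsIso (α.app (yoneda.obj c))) :
    IsIso α := by
  have : ∀ c, IsIso ((Functor.whiskerLeft yoneda α).app c) := h
  have : IsIso (Functor.whiskerLeft yoneda α) := NatIso.isIso_of_isIso_app _
  obtain ⟨e, he⟩ := cocontinuous_exists_iso (asIso (Functor.whiskerLeft yoneda α))
  have : α = e.hom := cocontinuous_hom_ext fun c => (he c).symm
  rw [this]
  infer_instance

end

/-- Direct images of Kan extensions into presheaf categories are left Kan extensions. -/
theorem exists_unique_desc_of_isIso_yoneda {A B : Type*} [Category* A] [Category* B] {f : A ⥤ B}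
    {xi : (Cᵒᵖ ⥤ Type u) ⥤ A} {xd : A ⥤ Cᵒᵖ ⥤ Type u} (ax : xi ⊣ xd)
    {ri : (Cᵒᵖ ⥤ Type u) ⥤ B} {rd : B ⥤ Cᵒᵖ ⥤ Type u} (ar : ri ⊣ rd)
    (γ : ri ⟶ xi ⋙ f) (hγ : ∀ c, IsIso (γ.app (yoneda.obj c))) (k : xd ⟶ f ⋙ rd)
    (hk : ∀ (P : Cᵒᵖ ⥤ Type u) (a : A) (z : P ⟶ xd.obj a),
      z ≫ k.app a = ar.homEquiv _ _ (γ.app P ≫ f.map ((ax.homEquiv _ _).symm z)))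
    (G : B ⥤ Cᵒᵖ ⥤ Type u) (α : xd ⟶ f ⋙ G) :
    ∃! β : rd ⟶ G, k ≫ Functor.whiskerLeft f β = α := by
  have hu : ∀ (c : C) (a : A) (z : yoneda.obj c ⟶ xd.obj a),
      ax.homEquiv _ _ (𝟙 (xi.obj (yoneda.obj c))) ≫ xd.map ((ax.homEquiv _ _).symm z) = z :=
    fun c a z => by
      rw [← ax.homEquiv_naturality_right, Category.id_comp, Equiv.apply_symm_apply]
  -- The value is forced: `z` transposes to a map out of `ri (y c)`, which `γ` identifies with `f
  -- (xi (y c))`. Apply `G` to that map, starting from the image under `α` of the universal element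
  -- of `xd (xi (y c))`.
  obtain ⟨t, ht⟩ : ∃ t : ∀ (b : B) (c : C), (yoneda.obj c ⟶ rd.obj b) → (yoneda.obj c ⟶ G.obj b),
      ∀ b c z, t b c z = ax.homEquiv _ _ (𝟙 (xi.obj (yoneda.obj c))) ≫
        α.app (xi.obj (yoneda.obj c)) ≫
          G.map (inv (γ.app (yoneda.obj c)) ≫ (ar.homEquiv (yoneda.obj c) b).symm z) :=
    ⟨_, fun _ _ _ => rfl⟩
  have ht' : ∀ (b : B) {c c' : C} (m : c ⟶ c') (z : yoneda.obj c' ⟶ rd.obj b),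
      t b c (yoneda.map m ≫ z) = yoneda.map m ≫ t b c' z := fun b c c' m z => by
    have h₁ : inv (γ.app (yoneda.obj c)) ≫ ri.map (yoneda.map m) =
        f.map (xi.map (yoneda.map m)) ≫ inv (γ.app (yoneda.obj c')) := by
      rw [IsIso.inv_comp_eq, ← Category.assoc, IsIso.eq_comp_inv]
      exact γ.naturality _
    have h₂ : xd.map (xi.map (yoneda.map m)) ≫ α.app (xi.obj (yoneda.obj c')) =
        α.app (xi.obj (yoneda.obj c)) ≫ G.map (f.map (xi.map (yoneda.map m))) := α.naturality _
    have h₃ : ax.homEquiv _ _ (𝟙 (xi.obj (yoneda.obj c))) ≫ xd.map (xi.map (yoneda.map m)) =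
        yoneda.map m ≫ ax.homEquiv _ _ (𝟙 (xi.obj (yoneda.obj c'))) := by
      rw [← ax.homEquiv_naturality_right, ← ax.homEquiv_naturality_left, Category.id_comp,
        Category.comp_id]
    rw [ht, ht, ar.homEquiv_naturality_left_symm, reassoc_of% h₁, G.map_comp, ← reassoc_of% h₂,
      reassoc_of% h₃]
  choose β hβ using fun b => exists_presheaf_hom (t b) (ht' b)
  refine ⟨⟨β, fun b b' g => presheaf_hom_ext fun c z => ?_⟩, ?_, fun β' h => ?_⟩
  · rw [← Category.assoc, hβ, ← Category.assoc, hβ, ht, ht, ar.homEquiv_naturality_right_symm]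
    simp only [Functor.map_comp, Category.assoc]
  · ext a : 2
    refine presheaf_hom_ext fun c z => ?_
    change z ≫ k.app a ≫ β (f.obj a) = _
    rw [← Category.assoc, hβ, hk, ht, Equiv.symm_apply_apply, IsIso.inv_hom_id_assoc]
    have h₁ : xd.map ((ax.homEquiv (yoneda.obj c) a).symm z) ≫ α.app a =
      α.app _ ≫ G.map (f.map ((ax.homEquiv (yoneda.obj c) a).symm z)) := α.naturality _
    rw [← h₁, reassoc_of% (hu c a z)]
  · ext b : 2
    refine presheaf_hom_ext fun c z => ?_
    rw [hβ, ht, ← h]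
    -- Uniqueness: at the universal element, the condition on `k` reduces to the transpose of `γ`,
    -- so `β'` is determined there by `α` and elsewhere by naturality.
    have h₁ := hk _ _ (ax.homEquiv _ _ (𝟙 (xi.obj (yoneda.obj c))))
    rw [Equiv.symm_apply_apply, f.map_id] at h₁
    have h₂ : rd.map (inv (γ.app (yoneda.obj c)) ≫ (ar.homEquiv _ _).symm z) ≫ β'.app b =
      β'.app (f.obj (xi.obj (yoneda.obj c))) ≫ G.map _ := β'.naturality _
    have h₃ := ar.homEquiv_naturality_right (γ.app (yoneda.obj c) ≫ 𝟙 _)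
      (inv (γ.app (yoneda.obj c)) ≫ (ar.homEquiv _ _).symm z)
    rw [Category.assoc, Category.id_comp, IsIso.hom_inv_id_assoc, Equiv.apply_symm_apply] at h₃
    change z ≫ β'.app b = _ ≫ (k.app _ ≫ β'.app (f.obj (xi.obj (yoneda.obj c)))) ≫ _
    rw [Category.assoc, ← h₂]
    refine (congrArg (· ≫ β'.app b) (h₃.trans (congrArg (· ≫ _) h₁.symm))).trans ?_
    simp only [Category.assoc]

end Presheaves

/-! ### Mates computed on generalized elements -/

theorem comp_conjugateEquiv_app {C D : Type*} [Category* C] [Category* D] {L₁ L₂ : C ⥤ D}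
    {R₁ R₂ : D ⥤ C} (adj₁ : L₁ ⊣ R₁) (adj₂ : L₂ ⊣ R₂) (α : L₂ ⟶ L₁) {c : C} {d : D}
    (z : c ⟶ R₁.obj d) : z ≫ (conjugateEquiv adj₁ adj₂ α).app d =
      adj₂.homEquiv _ _ (α.app c ≫ (adj₁.homEquiv _ _).symm z) := by
  rw [conjugateEquiv_apply_app, adj₂.homEquiv_unit, adj₁.homEquiv_counit,
    ← α.naturality_assoc, R₂.map_comp, ← adj₂.unit_naturality_assoc]
  simp

/-- When `κ` is the transpose of `γ`, its mate satisfies the hypothesis `hk` of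
`exists_unique_desc_of_isIso_yoneda`. -/
theorem comp_conjugateEquiv_comp_app {P A B : Type*} [Category* P] [Category* A] [Category* B]
    {xi : P ⥤ A} {xd : A ⥤ P} (ax : xi ⊣ xd) {ri : P ⥤ B} {rd : B ⥤ P} (ar : ri ⊣ rd)
    {fi : B ⥤ A} {fd : A ⥤ B} (af : fi ⊣ fd) (γ : ri ⟶ xi ⋙ fd) (κ : ri ⋙ fi ⟶ xi)
    (hκ : ∀ p, κ.app p = fi.map (γ.app p) ≫ af.counit.app (xi.obj p)) {p : P} {a : A}
    (z : p ⟶ xd.obj a) :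
    z ≫ (conjugateEquiv ax (ar.comp af) κ).app a =
      ar.homEquiv _ _ (γ.app p ≫ fd.map ((ax.homEquiv _ _).symm z)) := by
  rw [comp_conjugateEquiv_app, hκ, Adjunction.comp_homEquiv]
  change ar.homEquiv _ _ (af.homEquiv _ _ _) = _
  rw [Category.assoc, ← af.counit_naturality, ← Category.assoc, ← fi.map_comp,
    ← af.homEquiv_counit, Equiv.apply_symm_apply]

/-! ### Kan injectivity of free topoi -/

namespace Topos

variable {A B X Y : Topos.{u}}

theorem invIm_cocontinuous (f : X ⟶ Y) : PreservesColimitsOfSize.{u, u} (invIm f) :=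
  inferInstance

/-- The transpose is `f^* γ` followed by the counit of `f^* ⊣ f_*`, which is invertible for an
embedding. -/
theorem isIso_transpose_symm_app {f : A ⟶ B} (hf : embeddings f) {L : X.carrier ⥤ B.carrier}
    {G : X.carrier ⥤ A.carrier} (γ : L ⟶ G ⋙ dirIm f) (Z : X.carrier) (h : IsIso (γ.app Z)) :
    IsIso (((transpose f).symm γ).app Z) := by
  obtain ⟨_, _⟩ := hf
  rw [transpose_symm_app]
  exact IsIso.comp_isIso

section

variable {C : Type u} [SmallCategory C] {f : A ⟶ B} {x : A ⟶ pshTopos C} {r : B ⟶ pshTopos C}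
  {γ : invIm r ⟶ invIm x ⋙ dirIm f}

/-- A natural transformation of functors on presheaves is invertible on representables. -/
def IsIsoOnRepresentables {E : Type*} [Category* E] {L G : (pshTopos C).carrier ⥤ E} (γ : L ⟶ G) :
    Prop :=
  ∀ c : C, IsIso (NatTrans.app (C := Cᵒᵖ ⥤ Type u) γ (yoneda.obj c))

theorem isRightKan_cellOfTranspose (hγ : IsIsoOnRepresentables γ) :
    IsRightKan f x r (cellOfTranspose f γ) :=
  isRightKan_cellOfTranspose_iff.2 fun y δ =>
    let L : (Cᵒᵖ ⥤ Type u) ⥤ B.carrier := invIm y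
    have : PreservesColimitsOfSize.{u, u} L := invIm_cocontinuous y
    exists_unique_cocontinuous_lift (C := C) (L := invIm r) (L' := L)
      (G := invIm x ⋙ dirIm f) γ hγ δ

theorem isPointwise_cellOfTranspose (hγ : IsIsoOnRepresentables γ) :
    IsPointwise directImage.{u} f x r (cellOfTranspose f γ) :=
  isPointwise_iff.2 fun G _ α =>
    exists_unique_desc_of_isIso_yoneda (C := C) (f := dirIm f) (xi := invIm x) (xd := dirIm x)
      (GeomMorphism.adj x) (ri := invIm r) (rd := dirIm r) (GeomMorphism.adj r) γ hγ
      (GeomMorphism.dir₂ (cellOfTranspose f γ))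
      (fun _ a z => (congrArg (fun t => z ≫ NatTrans.app t a)
          (GeomTrans.mate (cellOfTranspose f γ)).symm).trans
        (comp_conjugateEquiv_comp_app (GeomMorphism.adj x) (GeomMorphism.adj r)
          (GeomMorphism.adj f) γ _ (transpose_symm_app f γ) z)) G α

theorem isIso_cellOfTranspose (hγ : IsIsoOnRepresentables γ) (hf : embeddings f) :
    IsIso (cellOfTranspose f γ) := by
  refine isIso_of_inv₂ _ ?_
  let L : (Cᵒᵖ ⥤ Type u) ⥤ A.carrier := invIm (f ≫ r)
  let G : (Cᵒᵖ ⥤ Type u) ⥤ A.carrier := invIm x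
  have : PreservesColimitsOfSize.{u, u} L := invIm_cocontinuous (f ≫ r)
  have : PreservesColimitsOfSize.{u, u} G := invIm_cocontinuous x
  refine isIso_of_isIso_yoneda (C := C) (L := L) (G := G) _ fun c => ?_
  exact isIso_transpose_symm_app hf γ _ (hγ c)

variable (f x)

/-- The inverse image of `r` is the Yoneda extension of `f_* x^*` restricted to representables. That
restriction is left exact, so the extension is too. -/
theorem exists_isIsoOnRepresentables [HasFiniteLimits C] :
    ∃ (r : B ⟶ pshTopos C) (γ : invIm r ⟶ invIm x ⋙ dirIm f), IsIsoOnRepresentables γ := by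
  let xi : (Cᵒᵖ ⥤ Type u) ⥤ A.carrier := invIm x
  have : PreservesFiniteLimits xi := inferInstanceAs (PreservesFiniteLimits (invIm x))
  let F : C ⥤ B.carrier := yoneda ⋙ xi ⋙ dirIm f
  have : PreservesFiniteLimits F := comp_preservesFiniteLimits _ _
  have : PreservesFiniteLimits (yoneda ⋙ yonedaExt F) :=
    preservesFiniteLimits_of_natIso (yonedaCompYonedaExt F).symm
  have := B.isTopos.lex_of_yoneda_comp_lex (yonedaExt F)
  obtain ⟨γ, hγ⟩ := cocontinuous_exists_hom (L := yonedaExt F) (G := xi ⋙ dirIm f)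
    (yonedaCompYonedaExt F).hom
  refine ⟨@geomOfAdj B (pshTopos C) _ _ (yonedaExtAdjunction F) this, γ, fun c => ?_⟩
  have : IsIso (γ.app (yoneda.obj c)) := by
    rw [hγ]
    infer_instance
  exact this

end

theorem pshTopos_wrInjPw (C : Type u) [SmallCategory C] [HasFiniteLimits C] :
    (WRInjPw directImage.{u} allGeom.{u}).obj (pshTopos C) := by
  refine ⟨fun A B f _ x => ?_, fun A B f _ x r κ hr => ?_⟩
  · obtain ⟨r, γ, hγ⟩ := exists_isIsoOnRepresentables f x
    exact ⟨r, _, isRightKan_cellOfTranspose hγ⟩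
  · obtain ⟨r', γ, hγ⟩ := exists_isIsoOnRepresentables f x
    exact (isPointwise_cellOfTranspose hγ).of_isRightKan (isRightKan_cellOfTranspose hγ) hr

theorem pshTopos_rInj (C : Type u) [SmallCategory C] [HasFiniteLimits C] :
    (RInj embeddings.{u}).obj (pshTopos C) := fun A B f hf x => by
  obtain ⟨r, γ, hγ⟩ := exists_isIsoOnRepresentables f x
  exact ⟨r, _, isRightKan_cellOfTranspose hγ, isIso_cellOfTranspose hγ hf⟩

theorem isCoadjointRetract_of_equivalence (e : X.carrier ≌ Y.carrier) : IsCoadjointRetract X Y := by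
  let s : X ⟶ Y := geomOfAdj e.symm.toAdjunction
  let r : Y ⟶ X := geomOfAdj e.toAdjunction
  exact ⟨s, r, ⟨adjunctionOfInv (s := s) (r := r) e.toAdjunction⟩,
    ⟨isoOfInv (f := s ≫ r) (g := 𝟙 X) e.unitIso.symm⟩⟩

theorem _root_.KanTopoi.IsFree.wrInjPw (h : IsFree X) :
    (WRInjPw directImage.{u} allGeom.{u}).obj X := by
  obtain ⟨C, _, _, ⟨e⟩⟩ := h
  exact (isCoadjointRetract_of_equivalence (Y := pshTopos C) e).wrInjPw_obj (pshTopos_wrInjPw C)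

theorem _root_.KanTopoi.IsFree.rInj (h : IsFree X) : (RInj embeddings.{u}).obj X := by
  obtain ⟨C, _, _, ⟨e⟩⟩ := h
  exact fun A B f hf =>
    (isCoadjointRetract_of_equivalence (Y := pshTopos C) e).isRetract.isRightKanInjective f
      (pshTopos_rInj C f hf)

end Topos

/-! ## Dense reflections of presheaf categories -/

section Reflection

variable {D : Type u} [SmallCategory D] {E : Type*} [Category* E]
  {si : (Dᵒᵖ ⥤ Type u) ⥤ E} {sd : E ⥤ Dᵒᵖ ⥤ Type u} (adj : si ⊣ sd)

include adj in
theorem hom_ext_of_reflection [sd.Faithful] {x x' : E} {v v' : x ⟶ x'}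
    (h : ∀ (d : D) (m : si.obj (yoneda.obj d) ⟶ x), m ≫ v = m ≫ v') : v = v' :=
  sd.map_injective (presheaf_hom_ext fun d z => by
    obtain ⟨m, rfl⟩ := (adj.homEquiv _ _).surjective z
    rw [← adj.homEquiv_naturality_right, ← adj.homEquiv_naturality_right, h])

variable [PreservesColimitsOfSize.{u, u} si]
  (hu : ∀ d : D, IsIso (adj.unit.app (yoneda.obj d)))

include hu in
/-- The reflector is the left Kan extension of the identity along the inclusion. -/
theorem exists_unique_desc_of_reflection [sd.Full] [sd.Faithful] (G : (Dᵒᵖ ⥤ Type u) ⥤ E)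
    (α : 𝟭 E ⟶ sd ⋙ G) :
    ∃! β : si ⟶ G, inv adj.counit ≫ Functor.whiskerLeft sd β = α := by
  have h₀ : ∀ d, IsIso ((Functor.whiskerLeft yoneda adj.unit).app d) := hu
  have h₁ : IsIso (Functor.whiskerLeft yoneda adj.unit) := NatIso.isIso_of_isIso_app _
  -- On representables the unit is invertible, so `β` can only be `α` followed by `G` of the inverse
  -- unit.
  obtain ⟨β, hβ⟩ := cocontinuous_exists_hom (L := si) (G := G)
    (Functor.whiskerLeft (yoneda ⋙ si) α ≫
      Functor.whiskerRight (inv (Functor.whiskerLeft yoneda adj.unit)) G)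
  have hβ' : ∀ d, β.app (yoneda.obj d) ≫ G.map (adj.unit.app (yoneda.obj d)) =
      α.app (si.obj (yoneda.obj d)) := fun d => by
    simp [hβ]
  refine ⟨β, ?_, fun β' h => ?_⟩
  · refine (IsIso.inv_comp_eq _).2 ?_
    ext x
    rw [← cancel_epi (inv (adj.counit.app x))]
    refine hom_ext_of_reflection adj fun d (m : si.obj (yoneda.obj d) ⟶ x) => ?_
    -- Generators of `E` have the form `si (y d)`. Rewriting a map out of one as `si` of its
    -- transpose reduces the check to naturality of `β` and its value on representables.
    have h₂ : m ≫ inv (adj.counit.app x) = si.map (adj.homEquiv _ _ m) := by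
      rw [IsIso.comp_inv_eq, ← adj.homEquiv_counit, Equiv.symm_apply_apply]
    have h₃ := β.naturality (adj.homEquiv _ _ m)
    have h₄ : m ≫ α.app x = α.app _ ≫ G.map (sd.map m) := α.naturality m
    change m ≫ inv (adj.counit.app x) ≫ β.app (sd.obj x) =
      m ≫ inv (adj.counit.app x) ≫ adj.counit.app x ≫ α.app x
    rw [IsIso.inv_hom_id_assoc, reassoc_of% h₂, h₃, h₄, adj.homEquiv_unit, G.map_comp,
      reassoc_of% hβ']
  · refine cocontinuous_hom_ext fun d => ?_
    rw [← cancel_mono (G.map (adj.unit.app (yoneda.obj d))), hβ', ← h]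
    have h₂ := β'.naturality (adj.unit.app (yoneda.obj d))
    refine h₂.symm.trans ?_
    have h₃ := adj.left_triangle_components (yoneda.obj d)
    have h₄ : si.map (adj.unit.app (yoneda.obj d)) =
        inv (adj.counit.app (si.obj (yoneda.obj d))) := IsIso.eq_inv_of_inv_hom_id h₃
    change si.map (adj.unit.app (yoneda.obj d)) ≫ _ =
      (inv adj.counit).app _ ≫ β'.app (sd.obj (si.obj (yoneda.obj d)))
    rw [h₄, NatIso.isIso_inv_app]
    rfl

include hu in
-- The unit is `κ⁻¹`. The counit `θ` is given on representables by `γ` followed by the inverse unit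
-- of `adj`. One triangle amounts to `si θ = κ si`, which may be checked on representables. The
-- other amounts to `θ ri = ri κ`; the cancellation hypothesis `h` reduces it to an equation after
-- composing with `γ`, where it becomes naturality of `κ`.
theorem nonempty_adjunction_of_reflection {ri : E ⥤ Dᵒᵖ ⥤ Type u}
    [PreservesColimitsOfSize.{u, u} ri] (κ : ri ⋙ si ⟶ 𝟭 E) [IsIso κ] (γ : ri ⟶ sd)
    (hγ : ∀ x, si.map (γ.app x) ≫ adj.counit.app x = κ.app x)
    (h : ∀ β β' : ri ⋙ si ⋙ ri ⟶ ri, β ≫ γ = β' ≫ γ → β = β') : Nonempty (ri ⊣ si) := by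
  have h₀ : ∀ d, IsIso ((Functor.whiskerLeft yoneda adj.unit).app d) := hu
  have h₁ : IsIso (Functor.whiskerLeft yoneda adj.unit) := NatIso.isIso_of_isIso_app _
  obtain ⟨θ, hθ⟩ := cocontinuous_exists_hom (L := si ⋙ ri) (G := 𝟭 _)
    (Functor.whiskerLeft (yoneda ⋙ si) γ ≫ inv (Functor.whiskerLeft yoneda adj.unit))
  have key : Functor.whiskerRight θ si = Functor.whiskerLeft si κ :=
    cocontinuous_hom_ext fun d => by
      have h₂ : θ.app (yoneda.obj d) ≫ adj.unit.app (yoneda.obj d) =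
          γ.app (si.obj (yoneda.obj d)) := by
        simp [hθ]
      change si.map (θ.app _) = κ.app (si.obj _)
      rw [← hγ, ← h₂, si.map_comp, Category.assoc]
      exact ((congrArg _ (adj.left_triangle_components _)).trans (Category.comp_id _)).symm
  have key' : ∀ z, si.map (θ.app z) = κ.app (si.obj z) := NatTrans.congr_app key
  have key₂ : Functor.whiskerLeft ri θ = Functor.whiskerRight κ ri := h _ _ (by
    ext x : 2
    apply (adj.homEquiv _ _).symm.injective
    rw [adj.homEquiv_counit, adj.homEquiv_counit]
    change si.map (θ.app (ri.obj x) ≫ γ.app x) ≫ _ = si.map (ri.map (κ.app x) ≫ γ.app x) ≫ _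
    rw [si.map_comp, si.map_comp, Category.assoc, Category.assoc, hγ, key']
    exact (κ.naturality (κ.app x)).symm)
  have key₂' : ∀ x, θ.app (ri.obj x) = ri.map (κ.app x) := NatTrans.congr_app key₂
  refine ⟨Adjunction.mkOfUnitCounit
    { unit := inv κ, counit := θ, left_triangle := ?_, right_triangle := ?_ }⟩
  · refine NatTrans.ext (funext fun x => ?_)
    change ri.map ((inv κ).app x) ≫ 𝟙 _ ≫ θ.app (ri.obj x) = 𝟙 _
    rw [key₂', Category.id_comp, ← ri.map_comp]
    exact (congrArg ri.map (NatTrans.congr_app (IsIso.inv_hom_id κ) x)).trans (ri.map_id _)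
  · ext z
    change (inv κ).app (si.obj z) ≫ 𝟙 _ ≫ si.map (θ.app z) = 𝟙 _
    rw [key', Category.id_comp]
    exact NatTrans.congr_app (IsIso.inv_hom_id κ) _

end Reflection

/-- Every topos is a dense reflection of presheaves on a small left exact category. -/
theorem IsGrothendieckTopos.exists_lex_reflection {E : Type (u + 1)} [Category.{u} E]
    (h : IsGrothendieckTopos E) :
    ∃ (D : Type u) (_ : SmallCategory D) (_ : HasFiniteLimits D) (si : (Dᵒᵖ ⥤ Type u) ⥤ E)
      (sd : E ⥤ Dᵒᵖ ⥤ Type u) (adj : si ⊣ sd), PreservesFiniteLimits si ∧ sd.Full ∧ sd.Faithful ∧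
        ∀ d : D, IsIso (adj.unit.app (yoneda.obj d)) := by
  have := h.hasLimits
  have := h.hasColimits
  obtain ⟨C, _, a, i, ⟨adj⟩, _, _, _⟩ := h.exists_reflection
  have := adj.leftAdjoint_preservesColimits
  -- Both are right adjoint to `a`. Hence this nerve is fully faithful, so `yoneda ⋙ a` is dense.
  let e : nerve (yoneda ⋙ a) ≅ i :=
    ((yonedaExtAdjunction _).ofNatIsoLeft
      (cocontinuous_exists_iso (L := yonedaExt (yoneda ⋙ a)) (G := a)
        (yonedaCompYonedaExt _)).choose).rightAdjointUniq adj
  have : (nerve (yoneda ⋙ a)).Full := Functor.Full.of_iso e.symm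
  have : (nerve (yoneda ⋙ a)).Faithful := Functor.Faithful.of_iso e.symm
  obtain ⟨D, _, _, K, _, _, _, _, _⟩ := exists_small_lex_dense (yoneda ⋙ a)
  have : PreservesFiniteLimits (yoneda ⋙ yonedaExt K) :=
    preservesFiniteLimits_of_natIso (yonedaCompYonedaExt K).symm
  refine ⟨D, inferInstance, inferInstance, yonedaExt K, nerve K, yonedaExtAdjunction K,
    h.lex_of_yoneda_comp_lex _, inferInstance, inferInstance, fun d => ?_⟩
  -- Full faithfulness of `K` puts representables in the image of the nerve, where the unit is
  -- invertible.
  let e : yoneda.obj d ≅ (nerve K).obj (K.obj d) :=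
    NatIso.ofComponents (fun c => ((Functor.FullyFaithful.ofFullyFaithful K).homEquiv).toIso)
  exact (yonedaExtAdjunction K).isIso_unit_app_of_iso e

namespace Topos

/-! ## Retracts of free topoi -/

variable {E F : Topos.{u}}

/-- Uniqueness of right adjoints gives `r_* ≅ s^*`, so on direct images `s ≫ r` is `s^* s_*`,
isomorphic to the identity because `s` is an embedding. -/
theorem isCoadjointRetract_of_adjunction {s : E ⟶ F} {r : F ⟶ E} (hs : embeddings s)
    (adj : invIm r ⊣ invIm s) : IsCoadjointRetract E F := by
  obtain ⟨_, _⟩ := hs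
  refine ⟨s, r, ⟨adjunctionOfInv adj⟩, ⟨GeomMorphism.isoOfDir (f := s ≫ r) (g := 𝟙 E) ?_⟩⟩
  exact (asIso (GeomMorphism.adj s).counit).symm ≪≫
    Functor.isoWhiskerLeft (dirIm s) (adj.rightAdjointUniq (GeomMorphism.adj r))

theorem isFree_pshTopos (C : Type u) [SmallCategory C] [HasFiniteLimits C] :
    IsFree (pshTopos C) :=
  ⟨C, inferInstance, inferInstance, ⟨CategoryTheory.Equivalence.refl⟩⟩

theorem exists_isCoadjointRetract_of_rInj (hE : (RInj embeddings.{u}).obj E) :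
    ∃ P : Topos.{u}, IsFree P ∧ IsCoadjointRetract E P := by
  obtain ⟨D, _, _, si, sd, adj, hsi, hsd, hsd', hu⟩ := E.isTopos.exists_lex_reflection
  let s : E ⟶ pshTopos D := @geomOfAdj E (pshTopos D) si sd adj hsi
  have hs : embeddings s := ⟨hsd, hsd'⟩
  obtain ⟨r, κ, hr, hκ⟩ := hE s hs (𝟙 E)
  let ri : E.carrier ⥤ Dᵒᵖ ⥤ Type u := invIm r
  let κ' : ri ⋙ si ⟶ 𝟭 E.carrier := GeomMorphism.inv₂ κ
  let γ : ri ⟶ sd := transpose s (GeomMorphism.inv₂ κ)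
  have : PreservesColimitsOfSize.{u, u} si := adj.leftAdjoint_preservesColimits
  have : PreservesColimitsOfSize.{u, u} ri := invIm_cocontinuous r
  have : IsIso κ' := inferInstanceAs (IsIso (GeomMorphism.inv₂ κ))
  have hγ : ∀ x, si.map (γ.app x) ≫ adj.counit.app x = κ'.app x := fun x => by
    have h := transpose_symm_app s (transpose s (GeomMorphism.inv₂ κ)) x
    rw [Equiv.symm_apply_apply] at h
    exact h.symm
  -- The required cancellation is uniqueness of factorisations through `κ`, tested on the 1-cell `r
  -- ≫ s ≫ r`.
  obtain ⟨a⟩ := nonempty_adjunction_of_reflection adj hu κ' γ hγ fun β β' h =>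
    (isRightKan_iff_inv.1 hr (r ≫ s ≫ r) (β ≫ γ)).unique rfl h.symm
  exact ⟨pshTopos D, isFree_pshTopos D, isCoadjointRetract_of_adjunction (s := s) (r := r) hs a⟩

theorem exists_isCoadjointRetract_of_wrInjPw
    (hE : (WRInjPw directImage.{u} allGeom.{u}).obj E) :
    ∃ P : Topos.{u}, IsFree P ∧ IsCoadjointRetract E P := by
  obtain ⟨D, _, _, si, sd, adj, hsi, hsd, hsd', hu⟩ := E.isTopos.exists_lex_reflection
  let s : E ⟶ pshTopos D := @geomOfAdj E (pshTopos D) si sd adj hsi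
  have hs : embeddings s := ⟨hsd, hsd'⟩
  obtain ⟨r, κ, hr⟩ := hE.1 s trivial (𝟙 E)
  have hp := isPointwise_iff.1 (hE.2 s trivial _ _ _ hr)
  have : PreservesColimitsOfSize.{u, u} si := adj.leftAdjoint_preservesColimits
  let ri : E.carrier ⥤ Dᵒᵖ ⥤ Type u := invIm r
  let rd : (Dᵒᵖ ⥤ Type u) ⥤ E.carrier := dirIm r
  have hrd : PreservesFiniteLimits rd := dirIm_lex r
  let k : 𝟭 E.carrier ⟶ sd ⋙ rd := GeomMorphism.dir₂ κ
  have h₁ : ∀ G : (Dᵒᵖ ⥤ Type u) ⥤ E.carrier, PreservesFiniteLimits G →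
      ∀ α : 𝟭 E.carrier ⟶ sd ⋙ G, ∃! β : rd ⟶ G, k ≫ Functor.whiskerLeft sd β = α :=
    fun G hG α => hp G hG α
  have h₂ := exists_unique_desc_of_reflection adj hu
  -- The universal property of `r_*` holds against left exact functors, and `s^*` is one. Comparing
  -- with the universal property of `s^*` in both directions gives `r_* ≅ s^*`.
  obtain ⟨a, ha, -⟩ := h₁ si hsi (inv adj.counit)
  obtain ⟨b, hb, -⟩ := h₂ rd k
  let e : rd ≅ si :=
    { hom := a
      inv := b
      hom_inv_id := (h₁ rd hrd k).unique
        (by rw [Functor.whiskerLeft_comp, ← Category.assoc, ha, hb])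
        (by rw [Functor.whiskerLeft_id']; exact Category.comp_id _)
      inv_hom_id := (h₂ si (inv adj.counit)).unique
        (by rw [Functor.whiskerLeft_comp, ← Category.assoc, hb, ha])
        (by rw [Functor.whiskerLeft_id']; exact Category.comp_id _) }
  let ar : ri ⊣ rd := GeomMorphism.adj r
  exact ⟨pshTopos D, isFree_pshTopos D,
    isCoadjointRetract_of_adjunction (s := s) (r := r) hs (ar.ofNatIsoRight e)⟩

theorem tfae_retract_free (E : Topos.{u}) : List.TFAE
    [∃ P : Topos.{u}, IsFree P ∧ IsCoadjointRetract E P,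
      ∃ P : Topos.{u}, IsFree P ∧ IsRetract E P,
      (RInj embeddings.{u}).obj E,
      (WRInjPw directImage.{u} allGeom.{u}).obj E] := by
  tfae_have 1 → 2 := fun ⟨P, hP, h⟩ => ⟨P, hP, h.isRetract⟩
  tfae_have 2 → 3 := fun ⟨P, hP, h⟩ A B f hf => h.isRightKanInjective f (hP.rInj f hf)
  tfae_have 3 → 1 := exists_isCoadjointRetract_of_rInj
  tfae_have 1 → 4 := fun ⟨P, hP, h⟩ => h.wrInjPw_obj hP.wrInjPw
  tfae_have 4 → 1 := exists_isCoadjointRetract_of_wrInjPw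
  tfae_finish

/-! ## Free topoi and weak right Kan injectivity -/

theorem freeTopoi_contained : FreeTopoi.{u}.Contained (WRInj allGeom.{u}) :=
  ⟨fun _ h => h.wrInjPw.1, fun _ _ f h _ hf => (wrInj_hom_iff_isEthereal h.wrInjPw.1 f).2 hf⟩

/-- Both sides wrap the same 1-cells and 2-cells of `Topos`; the content is that 1-cells of `WRInj
allGeom` out of a free topos are ethereal. -/
theorem inclusion_isTwoFullyFaithful :
    IsTwoFullyFaithful (LocallyFullSub.inclusion freeTopoi_contained.{u}) := fun a b => by
  refine ⟨⟨fun f g h => ?_, fun g => ?_⟩, fun f g => ⟨fun η θ h => ?_, fun η => ?_⟩⟩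
  · have h' : LocallyFullSub.val₁ f = LocallyFullSub.val₁ g :=
      congrArg (LocallyFullSub.val₁ (S := WRInj allGeom.{u})) h
    exact LocallyFullSub.Hom.ext h'
  · exact ⟨LocallyFullSub.Hom.mk (a := a) (b := b)
      (LocallyFullSub.val₁ (S := WRInj allGeom.{u}) g)
      ((wrInj_hom_iff_isEthereal a.property.wrInjPw.1 _).1
        (LocallyFullSub.val₁_mem (S := WRInj allGeom.{u}) g)), rfl⟩
  · have h' : LocallyFullSub.val₂ η = LocallyFullSub.val₂ θ :=
      congrArg (LocallyFullSub.val₂ (S := WRInj allGeom.{u})) h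
    exact LocallyFullSub.Hom₂.ext h'
  · exact ⟨LocallyFullSub.Hom₂.mk (f := f) (g := g)
      (LocallyFullSub.val₂ (S := WRInj allGeom.{u}) η), rfl⟩

theorem wrInjPw_obj_iff_exists_inclusion (X : Topos.{u}) :
    (WRInjPw directImage.{u} allGeom.{u}).obj X ↔ ∃ P : FreeTopoi.{u}.Obj,
      IsCoadjointRetract X ((LocallyFullSub.inclusion freeTopoi_contained.{u}).obj P).val := by
  refine ((tfae_retract_free X).out 3 0).trans ⟨?_, ?_⟩
  · rintro ⟨P, hP, h⟩
    exact ⟨⟨P, hP⟩, h⟩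
  · rintro ⟨P, h⟩
    exact ⟨P.val, P.property, h⟩

end Topos

/-! ## Restriction functors between presheaf categories -/

section Restriction

variable {C D : Type u} [SmallCategory C] [SmallCategory D]

theorem whiskeringLeft_op_map_injective {F G : D ⥤ C} {η θ : F ⟶ G}
    (h : (Functor.whiskeringLeft _ _ (Type u)).map (NatTrans.op η) =
      (Functor.whiskeringLeft _ _ (Type u)).map (NatTrans.op θ)) : η = θ := by
  ext d
  have := congr($(NatTrans.congr_app (NatTrans.congr_app h (yoneda.obj (G.obj d))) (op d))
    (𝟙 (G.obj d)))
  simpa using this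

/-- By the Yoneda lemma, a family `P (G d) → P (F d)` natural in `P` is determined by the image of
the identity in the representable on `G d`. -/
theorem whiskeringLeft_op_map_surjective {F G : D ⥤ C}
    (β : (Functor.whiskeringLeft _ _ (Type u)).obj G.op ⟶
      (Functor.whiskeringLeft _ _ (Type u)).obj F.op) :
    ∃ η : F ⟶ G, (Functor.whiskeringLeft _ _ (Type u)).map (NatTrans.op η) = β := by
  let t : ∀ (P : Cᵒᵖ ⥤ Type u) (d : D), P.obj (op (G.obj d)) → P.obj (op (F.obj d)) :=
    fun P d p => (β.app P).app (op d) p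
  have h₁ : ∀ (P : Cᵒᵖ ⥤ Type u) {d d' : D} (k : d ⟶ d') (p : P.obj (op (G.obj d'))),
      t P d (P.map (G.map k).op p) = P.map (F.map k).op (t P d' p) :=
    fun P d d' k p => congr($((β.app P).naturality k.op) p)
  have h₂ : ∀ {P Q : Cᵒᵖ ⥤ Type u} (m : P ⟶ Q) (d : D) (p : P.obj (op (G.obj d))),
      t Q d (m.app _ p) = m.app _ (t P d p) :=
    fun m d p => congr($(NatTrans.congr_app (β.naturality m) (op d)) p)
  let η : ∀ d, F.obj d ⟶ G.obj d := fun d => t (yoneda.obj (G.obj d)) d (𝟙 _)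
  refine ⟨⟨η, fun d d' k => ?_⟩, ?_⟩
  -- Naturality of `η`: the image of `G.map k` is computed once by naturality in `d` and once by
  -- naturality in the presheaf.
  · have e₁ := h₁ (yoneda.obj (G.obj d')) k (𝟙 _)
    have e₂ := h₂ (yoneda.map (G.map k)) d (𝟙 _)
    refine e₁.symm.trans (Eq.trans ?_ e₂)
    refine congrArg (t _ d) ?_
    exact (Category.comp_id _).trans (Category.id_comp _).symm
  · ext P d p
    have e₂ := h₂ (yonedaEquiv.symm p) d.unop (𝟙 _)
    refine Eq.trans ?_ (e₂.symm.trans ?_)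
    · exact (yonedaEquiv_symm_app_apply _ _ _).symm
    · exact congrArg (t P d.unop) (by simp)

/-- The restricted Yoneda functor of `F ⋙ yoneda` is restriction along `F`. -/
def nerveCompYonedaIso (F : D ⥤ C) :
    nerve (F ⋙ yoneda) ≅ (Functor.whiskeringLeft _ _ (Type u)).obj F.op :=
  NatIso.ofComponents
    (fun P => NatIso.ofComponents (fun d => yonedaEquiv.toIso) fun k => by
      ext z
      exact (yonedaEquiv_naturality z (F.map k.unop)).symm)
    fun m => by
      ext d z
      exact yonedaEquiv_comp z m

variable {L : (Dᵒᵖ ⥤ Type u) ⥤ (Cᵒᵖ ⥤ Type u)} {R : (Cᵒᵖ ⥤ Type u) ⥤ (Dᵒᵖ ⥤ Type u)}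
  (adj : L ⊣ R) [PreservesColimitsOfSize.{u, u} R]

include adj in
-- Maps out of `T = L (y d)` are elements of `R (-) (d)`, which is cocontinuous. As `T` is a colimit
-- of representables, its identity, seen as the unit, factors through one of them.
theorem exists_retract_of_representable (d : D) :
    ∃ (c : C) (i : L.obj (yoneda.obj d) ⟶ yoneda.obj c) (p : yoneda.obj c ⟶ L.obj (yoneda.obj d)),
      i ≫ p = 𝟙 _ := by
  let T := L.obj (yoneda.obj d)
  obtain ⟨j, z, hz⟩ := Types.jointly_surjective_of_isColimit
    (isColimitOfPreserves (R ⋙ (evaluation _ (Type u)).obj (op d))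
      (Presheaf.isColimitTautologicalCocone T)) (yonedaEquiv (adj.unit.app (yoneda.obj d)))
  change (R.obj (yoneda.obj j.left)).obj (op d) at z
  refine ⟨j.left, (adj.homEquiv _ _).symm (yonedaEquiv.symm z), j.hom, ?_⟩
  rw [← adj.homEquiv_naturality_right_symm, Equiv.symm_apply_eq, adj.homEquiv_id]
  apply yonedaEquiv.injective
  rw [yonedaEquiv_comp, Equiv.apply_symm_apply]
  exact hz

/-- The idempotent `p ≫ i` comes from `C` by full faithfulness of `yoneda` and splits there because
`C` has equalizers. -/
theorem mem_essImage_yoneda_of_retract [HasFiniteLimits C] {T : Cᵒᵖ ⥤ Type u} {c : C}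
    (i : T ⟶ yoneda.obj c) (p : yoneda.obj c ⟶ T) (h : i ≫ p = 𝟙 T) : yoneda.essImage T := by
  have : IsIdempotentComplete C :=
    (Idempotents.isIdempotentComplete_iff_hasEqualizer_of_id_and_idempotent _).2
      fun _ _ _ => inferInstance
  obtain ⟨e, he⟩ := yoneda.map_surjective (p ≫ i)
  obtain ⟨c', j, q, hjq, hqj⟩ := IsIdempotentComplete.idempotents_split c e
    (yoneda.map_injective (by simp [he, reassoc_of% h]))
  refine ⟨c', ⟨⟨yoneda.map j ≫ p, i ≫ yoneda.map q, ?_, ?_⟩⟩⟩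
  · have : yoneda.map j ≫ yoneda.map e ≫ yoneda.map q = 𝟙 _ := by
      rw [← yoneda.map_comp, ← yoneda.map_comp, ← hqj, Category.assoc, hjq, Category.comp_id, hjq,
        yoneda.map_id]
    rw [he] at this
    simpa using this
  · rw [Category.assoc, ← yoneda.map_comp_assoc, hqj, he, Category.assoc, h, Category.comp_id, h]

include adj in
-- Since `L` preserves representables, it restricts to some `F : D ⥤ C`, left exact because `yoneda`
-- reflects finite limits. Then `L` is the Yoneda extension of `F ⋙ yoneda`, and comparing right
-- adjoints identifies `R`.
theorem exists_iso_whiskeringLeft [HasFiniteLimits C] [PreservesFiniteLimits L] :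
    ∃ F : D ⥤ C, PreservesFiniteLimits F ∧
      Nonempty (R ≅ (Functor.whiskeringLeft _ _ (Type u)).obj F.op) := by
  have hL : ∀ d, yoneda.essImage ((yoneda ⋙ L).obj d) := fun d => by
    obtain ⟨c, i, p, h⟩ := exists_retract_of_representable adj d
    exact mem_essImage_yoneda_of_retract i p h
  let F : D ⥤ C := Functor.essImage.liftFunctor (yoneda ⋙ L) yoneda hL
  let e : F ⋙ yoneda ≅ yoneda ⋙ L := Functor.essImage.liftFunctorCompIso (yoneda ⋙ L) yoneda hL
  have : PreservesFiniteLimits (yoneda ⋙ L) := comp_preservesFiniteLimits _ _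
  have : PreservesFiniteLimits (F ⋙ yoneda) := preservesFiniteLimits_of_natIso e.symm
  have := adj.leftAdjoint_preservesColimits
  obtain ⟨a, -⟩ := cocontinuous_exists_iso (L := L) (G := yonedaExt (F ⋙ yoneda))
    (e.symm ≪≫ (yonedaCompYonedaExt _).symm)
  exact ⟨F, preservesFiniteLimits_of_reflects_of_preserves F yoneda,
    ⟨(adj.ofNatIsoLeft a).rightAdjointUniq (yonedaExtAdjunction _) ≪≫ nerveCompYonedaIso F⟩⟩

end Restriction

/-! ## The presheaf construction is a biequivalence -/

theorem FreeTopoi.nonempty_equivalence {E F : FreeTopoi.{u}.Obj}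
    (e : CategoryTheory.Equivalence E.val.carrier F.val.carrier) :
    Nonempty (Bicategory.Equivalence E F) := by
  let p : E.val ⟶ F.val := Topos.geomOfAdj e.symm.toAdjunction
  let q : F.val ⟶ E.val := Topos.geomOfAdj e.toAdjunction
  have hp : IsEthereal p := inferInstanceAs (PreservesColimitsOfSize.{u, u} e.functor)
  have hq : IsEthereal q := inferInstanceAs (PreservesColimitsOfSize.{u, u} e.inverse)
  let f : E ⟶ F := LocallyFullSub.Hom.mk (a := E) (b := F) p hp
  let g : F ⟶ E := LocallyFullSub.Hom.mk (a := F) (b := E) q hq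
  refine ⟨Bicategory.Equivalence.mkOfAdjointifyCounit (f := f) (g := g)
    (LocallyFullSub.isoMk ?_) (LocallyFullSub.isoMk ?_)⟩
  · exact Topos.isoOfInv (f := 𝟙 E.val) (g := p ≫ q) e.unitIso
  · exact Topos.isoOfInv (f := q ≫ p) (g := 𝟙 F.val) e.counitIso

theorem psh_exists_equivalence (E : FreeTopoi.{u}.Obj) :
    ∃ C : LexCat.{u}ᵒᵖ, Nonempty (Bicategory.Equivalence (psh.{u}.obj C) E) := by
  obtain ⟨C, _, _, ⟨e⟩⟩ := E.property
  exact ⟨op ⟨C⟩, FreeTopoi.nonempty_equivalence (E := freePsh ⟨C⟩) e.symm⟩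

/-- Everything is tested on direct images, where `psh` is restriction: 2-cells are handled by the
Yoneda lemma and 1-cells by `exists_iso_whiskeringLeft`. -/
theorem psh_mapFunctor_isEquivalence (a b : LexCat.{u}ᵒᵖ) :
    (psh.{u}.mapFunctor a b).IsEquivalence where
  faithful := ⟨fun {f g η θ} h => by
    have h' : GeomMorphism.dir₂ (LocallyFullSub.val₂ (psh.map₂ η)) =
        GeomMorphism.dir₂ (LocallyFullSub.val₂ (psh.map₂ θ)) :=
      congrArg (fun t => GeomMorphism.dir₂ (LocallyFullSub.val₂ t)) h
    exact congrArg Bicategory.Opposite.Hom2.op2' (LexCat.Hom₂.ext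
      (whiskeringLeft_op_map_injective h'))⟩
  full := ⟨fun {f g} θ => by
    obtain ⟨η, hη⟩ := whiskeringLeft_op_map_surjective (F := LexCat.fn f.unop)
      (G := LexCat.fn g.unop) (GeomMorphism.dir₂ (LocallyFullSub.val₂ θ))
    exact ⟨Bicategory.Opposite.Hom2.op2' ⟨η⟩, LocallyFullSub.Hom₂.ext
      (GeomMorphism.hom₂_ext_dir hη)⟩⟩
  essSurj := ⟨fun g => by
    let L : (b.unop.carrierᵒᵖ ⥤ Type u) ⥤ (a.unop.carrierᵒᵖ ⥤ Type u) :=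
      invIm (LocallyFullSub.val₁ g)
    let R : (a.unop.carrierᵒᵖ ⥤ Type u) ⥤ (b.unop.carrierᵒᵖ ⥤ Type u) :=
      dirIm (LocallyFullSub.val₁ g)
    let adj : L ⊣ R := GeomMorphism.adj (LocallyFullSub.val₁ g)
    have : PreservesFiniteLimits L := GeomMorphism.lex (LocallyFullSub.val₁ g)
    have : PreservesColimitsOfSize.{u, u} R := LocallyFullSub.val₁_mem g
    obtain ⟨F, hF, ⟨e⟩⟩ := exists_iso_whiskeringLeft adj
    let F' : b.unop ⟶ a.unop := LexCat.Hom.mk F hF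
    exact ⟨F'.op, ⟨LocallyFullSub.isoMk
      (GeomMorphism.isoOfDir (f := pshGeom F') (g := LocallyFullSub.val₁ g) e)⟩⟩⟩

theorem psh_isBiequivalence : IsBiequivalence psh.{u} :=
  ⟨psh_exists_equivalence, psh_mapFunctor_isEquivalence⟩

end

end KanTopoi

theorem mainTheorem7 :
    -- the characterisation of the topoi that are coadjoint retracts of free topoi
    (∀ E : KanTopoi.Topos.{u}, List.TFAE
      [∃ P : KanTopoi.Topos.{u}, KanTopoi.IsFree P ∧ KanTopoi.IsCoadjointRetract E P,
        ∃ P : KanTopoi.Topos.{u}, KanTopoi.IsFree P ∧ KanTopoi.IsRetract E P,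
        (KanTopoi.RInj KanTopoi.embeddings.{u}).obj E,
        (KanTopoi.WRInjPw KanTopoi.directImage.{u} KanTopoi.allGeom.{u}).obj E]) ∧
    -- the presheaf construction is a biequivalence
    KanTopoi.IsBiequivalence KanTopoi.psh.{u} ∧
    -- free topoi embed 2-fully faithfully, and the image up to coadjoint retracts is as described
    (∃ h : KanTopoi.FreeTopoi.{u}.Contained (KanTopoi.WRInj KanTopoi.allGeom.{u}),
      KanTopoi.IsTwoFullyFaithful (KanTopoi.LocallyFullSub.inclusion h) ∧
      ∀ X : KanTopoi.Topos.{u},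
        (KanTopoi.WRInjPw KanTopoi.directImage.{u} KanTopoi.allGeom.{u}).obj X ↔
          ∃ P : KanTopoi.FreeTopoi.{u}.Obj,
            KanTopoi.IsCoadjointRetract X ((KanTopoi.LocallyFullSub.inclusion h).obj P).val) ∧
    -- the 1-cells of the weak right Kan injectivity class are the ethereal geometric morphisms
    (∀ X Y : KanTopoi.Topos.{u},
      (KanTopoi.WRInj KanTopoi.allGeom.{u}).obj X →
      (KanTopoi.WRInj KanTopoi.allGeom.{u}).obj Y →
      ∀ f : X ⟶ Y,
        (KanTopoi.WRInj KanTopoi.allGeom.{u}).hom f ↔ KanTopoi.IsEthereal f) := by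
  exact ⟨KanTopoi.Topos.tfae_retract_free, KanTopoi.psh_isBiequivalence,
    ⟨KanTopoi.Topos.freeTopoi_contained, KanTopoi.Topos.inclusion_isTwoFullyFaithful,
      KanTopoi.Topos.wrInjPw_obj_iff_exists_inclusion⟩,
    fun _ _ hX _ f => KanTopoi.Topos.wrInj_hom_iff_isEthereal hX f⟩
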